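/- **Definitions.** Let $\mathcal B_0$ be the collection of unit circles centered at the points $(2m+n)+\sqrt{3}\,n\,i$, $m,n\in\mathbb Z$ (the triangular grid of circles), and let $\hat{\mathcal B}_0$ be the collection of inscribed circles (of radius $1/\sqrt3$) of the triangles of the grid. A *triangular packing* $\mathcal A$ is obtained from a Möbius transformation $g$: it is the orbit of the circles $g(\mathcal B_0)$ under the group generated by the reflections in the circles of $g(\hat{\mathcal B}_0)$. Circles are oriented generalized circles (lines have curvature $0$), the orientation being carried along by $g$, so that a circle has negative curvature if it contains the others. The packing is *integral* if all curvatures are integers, and *primitive* if the greatest common divisor of all the curvatures is $1$. It has *type $(1)$* if all curvatures are $\equiv 1 \bmod 12$, and *type $(3,11)$* if the residues of the curvatures modulo $12$ are exactly $3$ and $11$. Let $\left(\frac{\cdot}{\cdot}\right)$ be the Kronecker symbol, with $\left(\frac{x}{-1}\right)=1$ for $x\ge 0$ and $-1$ for $x<0$. Let $\mathcal A$ be a primitive integral triangular packing of type $(1)$ or $(3,11)$. For a circle $\mathcal C\in\mathcal A$ of curvature $a$, and $\rho=a+b$, where $b$ is the curvature of a circle of $\mathcal A$ tangent to $\mathcal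 C$ such that $\gcd(\rho,a)=1$, put $$\chi_2(\mathcal C)=\begin{cases}\left(\frac{\rho}{a}\right) & \text{if } a\equiv 1 \text{ or } 11 \bmod 12,\\[2pt] -\left(\frac{\rho}{a}\right) & \text{if } a\equiv 3 \bmod 12.\end{cases}$$ We write $\chi_2(\mathcal A)=-1$ if $\chi_2(\mathcal C)=-1$ for some circle $\mathcal C\in\mathcal A$ and some such choice of $\rho$. **Theorem.** Let $\mathcal A$ be a primitive integral triangular packing with $\chi_2(\mathcal A)=-1$. 1. If $\mathcal A$ is of type $(1)$, then no integer of the form $n^2$, $n\in\mathbb Z$, appears as a curvature in $\mathcal A$. 2. If $\mathcal A$ is of type $(3,11)$, then no integer of the form $3n^2$, $n\in\mathbb Z$, appears as a curvature in $\mathcal A$. In particular, in both cases the Local-Global Conjecture is false for $\mathcal A$: it is not true that every sufficiently large integer $n$ that satisfies all congruence restrictions (for every $m\ge1$, $n$ is congruent modulo $m$ to some curvature of $\mathcal A$) is a curvature of $\mathcal A$. -/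

import Mathlib

open scoped MatrixGroups ComplexConjugate

/-- An oriented generalized circle in `ℂ`, in inversive coordinates: `curvature` is the signed
curvature `b`, `cocurvature` is `b̃`, and `h` is the center times the curvature (for a line, where
`b = 0`, it is the oriented unit normal). The circle is the locus
`b |z|² - 2 Re (conj h * z) + b̃ = 0`, and its interior is the side where the left side is
negative: the bounded disk for `b > 0`, the exterior region for `b < 0`, a half plane
for `b = 0`. -/
@[ext]
structure OrientedCircle where
  cocurvature : ℝ
  curvature : ℝ
  h : ℂ
  norm_eq : Complex.normSq h - curvature * cocurvature = 1

namespace OrientedCircle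

/-- The circle with center `z` and radius `r`, bounding the disk of radius `r`. -/
noncomputable def ofCenterRadius (z : ℂ) (r : ℝ) (hr : 0 < r) : OrientedCircle where
  cocurvature := (Complex.normSq z - r ^ 2) / r
  curvature := 1 / r
  h := z / (r : ℂ)
  norm_eq := by
    have hr' : r ≠ 0 := hr.ne'
    rw [map_div₀, Complex.normSq_ofReal]
    field_simp
    ring

/-- The inversive product, the bilinear form of the quadratic form `|h|² - b b̃`. -/
noncomputable def inversiveProduct (C D : OrientedCircle) : ℝ :=
  (conj C.h * D.h).re - (C.curvature * D.cocurvature + D.curvature * C.cocurvature) / 2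

/-- External tangency: at the point of tangency the oriented unit normals are opposite. -/
def Tangent (C D : OrientedCircle) : Prop := C.inversiveProduct D = -1

/-- The image of `C` under the reflection (inversion) in `D`, that is `C - 2 ⟨C, D⟩ D`. -/
noncomputable def reflect (D C : OrientedCircle) : OrientedCircle where
  cocurvature := C.cocurvature - 2 * C.inversiveProduct D * D.cocurvature
  curvature := C.curvature - 2 * C.inversiveProduct D * D.curvature
  h := C.h - ((2 * C.inversiveProduct D : ℝ) : ℂ) * D.h
  norm_eq := by
    have hC := C.norm_eq
    have hD := D.norm_eq
    have key : C.inversiveProduct D = C.h.re * D.h.re + C.h.im * D.h.im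
        - (C.curvature * D.cocurvature + D.curvature * C.cocurvature) / 2 := by
      simp [inversiveProduct]
    generalize C.inversiveProduct D = t at key ⊢
    simp only [Complex.normSq_apply, Complex.sub_re, Complex.sub_im, Complex.re_ofReal_mul,
      Complex.im_ofReal_mul] at hC hD ⊢
    linear_combination hC + 4 * t ^ 2 * hD + 4 * t * key

/-- The image of `C` under the Möbius transformation `z ↦ (α z + β) / (γ z + δ)` with matrix `g`.
Substituting `z = (p w + q) / (r w + s)`, with `(p, q; r, s)` the inverse matrix, into the equation
`b |z|² - 2 Re (conj h * z) + b̃ = 0` of `C` and multiplying by `|r w + s|²` gives the equation of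
the image in the variable `w`, whose coefficients are the ones below. -/
noncomputable def moebius (g : SL(2, ℂ)) (C : OrientedCircle) : OrientedCircle :=
  let p : ℂ := g 1 1
  let q : ℂ := -g 0 1
  let r : ℂ := -g 1 0
  let s : ℂ := g 0 0
  { cocurvature := C.curvature * Complex.normSq q - 2 * (conj C.h * q * conj s).re
      + C.cocurvature * Complex.normSq s
    curvature := C.curvature * Complex.normSq p - 2 * (conj C.h * p * conj r).re
      + C.cocurvature * Complex.normSq r
    h := C.h * conj p * s + conj C.h * q * conj r
      - (C.curvature : ℂ) * conj p * q - (C.cocurvature : ℂ) * conj r * s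
    norm_eq := by
      have hC := C.norm_eq
      have hdet : p * s - q * r = 1 := by
        have h1 := g.det_coe
        rw [Matrix.det_fin_two] at h1
        simp only [p, q, r, s]
        linear_combination h1
      have hN : Complex.normSq (p * s - q * r) = 1 := by rw [hdet]; simp
      generalize p = p at hN ⊢
      generalize q = q at hN ⊢
      generalize r = r at hN ⊢
      generalize s = s at hN ⊢
      simp only [Complex.normSq_apply, Complex.sub_re, Complex.sub_im, Complex.add_re,
        Complex.add_im, Complex.mul_re, Complex.mul_im, Complex.conj_re, Complex.conj_im,
        Complex.ofReal_re, Complex.ofReal_im] at hC hN ⊢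
      linear_combination
        (C.h.re * C.h.re + C.h.im * C.h.im - C.curvature * C.cocurvature) * hN + hC }

end OrientedCircle

/-- The vertex `(m, n)` of the triangular lattice with edge length `2`. -/
noncomputable def gridPoint (m n : ℤ) : ℂ := ⟨2 * m + n, √3 * n⟩

/-- The standard base configuration: the unit circles centered at the vertices of the triangular
grid. Its tangency graph is the triangular tiling. -/
noncomputable def gridBase : Set OrientedCircle :=
  {C | ∃ m n : ℤ, C = OrientedCircle.ofCenterRadius (gridPoint m n) 1 one_pos}

/-- The standard dual configuration: the inscribed circles of the triangles of the grid, of radius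
`1 / √3`. The triangles are those with vertices `(m, n), (m + 1, n), (m, n + 1)` and those with
vertices `(m + 1, n), (m, n + 1), (m + 1, n + 1)`. -/
noncomputable def gridDual : Set OrientedCircle :=
  {D | ∃ m n : ℤ,
    D = OrientedCircle.ofCenterRadius
      ((gridPoint m n + gridPoint (m + 1) n + gridPoint m (n + 1)) / 3) (1 / √3) (by positivity) ∨
    D = OrientedCircle.ofCenterRadius
      ((gridPoint (m + 1) n + gridPoint m (n + 1) + gridPoint (m + 1) (n + 1)) / 3)
      (1 / √3) (by positivity)}

/-- The orbit of the circles in `base` under the group generated by the reflections in the circles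
of `dual`. (The generators are involutions.) -/
inductive ApollonianOrbit (base dual : Set OrientedCircle) : OrientedCircle → Prop
  | of_base {C : OrientedCircle} (hC : C ∈ base) : ApollonianOrbit base dual C
  | reflect {C D : OrientedCircle} (hD : D ∈ dual) (hC : ApollonianOrbit base dual C) :
      ApollonianOrbit base dual (D.reflect C)

/-- A triangular packing: for some Möbius transformation `g`, the orbit of the image under `g` of
the triangular grid of circles, under the Apollonian group generated by the reflections in the
images under `g` of the dual circles. -/
def IsTriangularPacking (A : Set OrientedCircle) : Prop :=
  ∃ g : SL(2, ℂ), A = {C | ApollonianOrbit (OrientedCircle.moebius g '' gridBase)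
    (OrientedCircle.moebius g '' gridDual) C}

/-- All curvatures are integers. -/
def IsIntegralPacking (A : Set OrientedCircle) : Prop :=
  ∀ C ∈ A, ∃ n : ℤ, C.curvature = n

/-- The integers that appear as curvatures in `A`. -/
def curvatures (A : Set OrientedCircle) : Set ℤ :=
  {n | ∃ C ∈ A, C.curvature = n}

/-- The greatest common divisor of all the curvatures is `1`. -/
def IsPrimitivePacking (A : Set OrientedCircle) : Prop :=
  ∀ d : ℕ, (∀ n ∈ curvatures A, (d : ℤ) ∣ n) → d = 1

/-- The curvatures of `A` represent exactly the residue classes in `S` modulo `12`. -/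
def HasType (A : Set OrientedCircle) (S : Set (ZMod 12)) : Prop :=
  (fun n : ℤ => (n : ZMod 12)) '' curvatures A = S

/-- The Kronecker symbol `(a / b)` for `b ≠ 0`: the factor at `-1` is `-1` exactly if `a` and `b`
are both negative, `(a / 2)` is the quadratic character `χ₈` modulo `8`, and the odd part
of `|b|` contributes a Jacobi symbol. -/
def kroneckerSymbol (a b : ℤ) : ℤ :=
  (if a < 0 ∧ b < 0 then -1 else 1) * ZMod.χ₈ (a : ZMod 8) ^ b.natAbs.factorization 2 *
    jacobiSym a (b.natAbs / 2 ^ b.natAbs.factorization 2)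

/-- The value of the quadratic invariant at a circle of curvature `a`, computed from `ρ`; for
packings of type `(1)` and `(3, 11)`, so that `a ≡ 1`, `3` or `11` modulo `12`. -/
def chiTwoAt (a ρ : ℤ) : ℤ :=
  if a ≡ 3 [ZMOD 12] then -kroneckerSymbol ρ a else kroneckerSymbol ρ a

/-- `χ₂ (C) = ε`, computed from some admissible `ρ`: one of the integers `ρ = a + b`, with `a` the
curvature of `C` and `b` the curvature of a circle of `A` tangent to `C`, that is coprime to `a`.
(The `a + b` are the values of the quadratic forms that parametrize the circles tangent to `C`.) -/
def HasChiTwoAt (A : Set OrientedCircle) (C : OrientedCircle) (ε : ℤ) : Prop :=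
  ∃ D ∈ A, C.Tangent D ∧ ∃ a b : ℤ, C.curvature = a ∧ D.curvature = b ∧
    IsCoprime (a + b) a ∧ chiTwoAt a (a + b) = ε

/-- `χ₂ (A) = ε`: the quadratic invariant takes the value `ε` at some circle of `A`. -/
def HasChiTwo (A : Set OrientedCircle) (ε : ℤ) : Prop :=
  ∃ C ∈ A, HasChiTwoAt A C ε

/-- `n` satisfies all the congruence restrictions on the curvatures of `A`. -/
def IsAdmissible (A : Set OrientedCircle) (n : ℤ) : Prop :=
  ∀ m : ℕ, 0 < m → ∃ c ∈ curvatures A, n ≡ c [ZMOD m]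

/-- The assertion of the Local-Global Conjecture for `A`: every sufficiently large integer that
satisfies the congruence restrictions is a curvature. -/
def LocalGlobal (A : Set OrientedCircle) : Prop :=
  ∃ N : ℤ, ∀ n : ℤ, N ≤ n → IsAdmissible A n → n ∈ curvatures A

/-!
The packing is moved to the standard configuration, where the circles become vectors of the rank
four lattice spanned by the circles of the triangular grid, with the inversive product as its
quadratic form, and the curvatures become the values of a linear form, the product with a null
vector (`NullForm`, `exists_nullForm`).

*The invariant at one circle.* By a ping-pong argument (`ReducedOrbit.vertex_or_insideOf`) the
circles tangent to a given circle of curvature `a` are those obtained from its six neighbors in the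
grid by the reflections in the six incircles around it (`ReducedOrbit.eq_or_inner_le`). Hence the
numbers `ρ = a + b` are values of two binary quadratic forms of discriminant `-12 a ^ 2`, and the
product of any two of them is `B ^ 2` or `3 B ^ 2` modulo `a` (`NullForm.mul_eq_of_tangent`). So the
symbol `(ρ / a)` does not depend on `ρ` (`IsRegular.chi_unique`).

*Constancy.* For tangent circles of coprime curvatures `a`, `b` and `ρ = a + b`, quadratic
reciprocity identifies the two values of `χ₂` (`chiTwoAt_comm`). Any two tangent circles are joined
by a path of tangent circles in which consecutive curvatures are coprime: the circles tangent to
both have curvatures `c + 6 t j + 3 (a + b) j ^ 2`, where `3 t ^ 2 = a b + b c + c a`, and for a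
suitable `j` this is coprime to `a` and `b`; if `3` divides just one of them, a longer path is
needed, since then `3` divides all these curvatures. Thus `χ₂` is constant on the packing
(`IsRegular.chi_iff`). As it is `1` at a circle of curvature `n ^ 2` or `3 n ^ 2`, there is no such
circle if it takes the value `-1`.

*The local-global conjecture.* The substitution `c ↦ c + 6 t j + 3 (a + b) j ^ 2` and its analogues
for `a` and `b` act on the quadruples `(a, b, c, t)` of the packing. A sequence of such moves can be
performed modulo one number and have no effect modulo a coprime one, so it suffices to attain a
value modulo prime powers (`Quad.exists_reach_modEq`). For primes `p ≥ 5` every value is attained,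
by solving a binary quadratic equation (`Quad.Valid.exists_reach_prime_pow`), and for `p = 2, 3` it
suffices that the value is congruent to a curvature modulo `4`, and modulo `9` for a suitable
quadruple. This provides arbitrarily large admissible numbers `n ^ 2` and `3 n ^ 2`.
-/

namespace TriangularPacking

/-! ### The lattice spanned by the grid and its reflection group -/

/-- A vector of the lattice spanned by the circles of the triangular grid, in coordinates adapted
to `OrientedCircle`: curvature `e`, cocurvature `4 f - e`, and `h = 2 (m + n ω)` where
`ω = exp (π i / 3)`. -/
@[ext]
structure LatticeVector where
  e : ℤ
  f : ℤ
  m : ℤ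
  n : ℤ

/-- The norm form `|m + n ω|²` of the Eisenstein integers. -/
def eisensteinNorm (m n : ℤ) : ℤ := m ^ 2 + m * n + n ^ 2

lemma eisensteinNorm_nonneg (m n : ℤ) : 0 ≤ eisensteinNorm m n := by
  unfold eisensteinNorm
  nlinarith [sq_nonneg (m + n), sq_nonneg m, sq_nonneg n]

lemma eisensteinNorm_pos {m n : ℤ} (h : m ≠ 0 ∨ n ≠ 0) : 0 < eisensteinNorm m n := by
  unfold eisensteinNorm
  rcases h with h | h
  · nlinarith [sq_nonneg (m + n), sq_nonneg n, sq_pos_of_ne_zero h]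
  · nlinarith [sq_nonneg (m + n), sq_nonneg m, sq_pos_of_ne_zero h]

/-- The inversive product, restricted to the lattice. -/
def inner (C D : LatticeVector) : ℤ :=
  4 * C.m * D.m + 4 * C.n * D.n + 2 * (C.m * D.n + C.n * D.m) - 2 * C.e * D.f - 2 * D.e * C.f
    + C.e * D.e

/-- The unit circle centered at the vertex `(m, n)` of the grid. -/
def vertex (m n : ℤ) : LatticeVector := ⟨1, eisensteinNorm m n, m, n⟩

/-- A triangle of the grid. Its center is `(2 / 3) ((3 x + i) + (3 y + i) ω)`, where `i = 1` for the
triangles pointing up and `i = -1` for those pointing down. -/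
@[ext]
structure Triangle where
  x : ℤ
  y : ℤ
  i : ℤ
  hi : i = 1 ∨ i = -1

namespace Triangle

/-- The integer `N / 9 - 1 / 3`, where `N` is the norm of `(3 x + i) + (3 y + i) ω`. It is
nonnegative and vanishes exactly for the six triangles at the origin. -/
def height (Δ : Triangle) : ℤ := eisensteinNorm Δ.x Δ.y + Δ.i * (Δ.x + Δ.y)

/-- The inversive product of `D` with the incircle of `Δ`, divided by `2 √3`. -/
def pair (Δ : Triangle) (D : LatticeVector) : ℤ :=
  D.m * (2 * Δ.x + Δ.y + Δ.i) + D.n * (Δ.x + 2 * Δ.y + Δ.i) - D.f - D.e * Δ.height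

/-- The multiple of the incircle of `Δ` by `4 √3`, a vector of the lattice. -/
def root (Δ : Triangle) : LatticeVector :=
  ⟨12, 6 + 12 * Δ.height, 4 * (3 * Δ.x + Δ.i), 4 * (3 * Δ.y + Δ.i)⟩

/-- The reflection in the incircle of `Δ`. -/
def reflect (Δ : Triangle) (D : LatticeVector) : LatticeVector :=
  ⟨D.e - Δ.pair D * Δ.root.e, D.f - Δ.pair D * Δ.root.f, D.m - Δ.pair D * Δ.root.m,
    D.n - Δ.pair D * Δ.root.n⟩

lemma i_sq (Δ : Triangle) : Δ.i ^ 2 = 1 := by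
  rcases Δ.hi with h | h <;> rw [h] <;> norm_num

lemma height_nonneg (Δ : Triangle) : 0 ≤ Δ.height := by
  have h := eisensteinNorm_nonneg (3 * Δ.x + Δ.i) (3 * Δ.y + Δ.i)
  have h2 : eisensteinNorm (3 * Δ.x + Δ.i) (3 * Δ.y + Δ.i) = 9 * Δ.height + 3 := by
    unfold height eisensteinNorm
    linear_combination 3 * Δ.i_sq
  omega

lemma pair_reflect (Δ Δ' : Triangle) (D : LatticeVector) :
    Δ'.pair (Δ.reflect D) = Δ'.pair D - Δ.pair D * Δ'.pair Δ.root := by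
  simp only [pair, reflect, root]
  ring

lemma pair_root_self (Δ : Triangle) : Δ.pair Δ.root = 2 := by
  simp only [pair, root, height, eisensteinNorm]
  linear_combination 8 * Δ.i_sq

lemma pair_reflect_self (Δ : Triangle) (D : LatticeVector) :
    Δ.pair (Δ.reflect D) = -Δ.pair D := by
  rw [pair_reflect, pair_root_self]
  ring

lemma reflect_reflect (Δ : Triangle) (D : LatticeVector) : Δ.reflect (Δ.reflect D) = D := by
  have h := Δ.pair_reflect_self D
  ext <;> simp only [reflect] at h ⊢ <;> rw [h] <;> ring

lemma reflect_eq_self {Δ : Triangle} {D : LatticeVector} (h : Δ.pair D = 0) :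
    Δ.reflect D = D := by
  ext <;> simp [reflect, h]

/-- The incircles of distinct triangles are disjoint or tangent. -/
lemma pair_root_le {Δ Δ' : Triangle} (h : Δ ≠ Δ') : Δ'.pair Δ.root ≤ -2 := by
  obtain ⟨x, y, i, hi⟩ := Δ
  obtain ⟨x', y', i', hi'⟩ := Δ'
  have key : 3 * pair ⟨x', y', i', hi'⟩ (root ⟨x, y, i, hi⟩)
      = 6 - 4 * eisensteinNorm (3 * (x - x') + (i - i')) (3 * (y - y') + (i - i')) := by
    rcases hi with rfl | rfl <;> rcases hi' with rfl | rfl <;>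
      simp only [pair, root, height, eisensteinNorm] <;> ring
  have hne : 3 * (x - x') + (i - i') ≠ 0 ∨ 3 * (y - y') + (i - i') ≠ 0 := by
    by_contra! hc
    apply h
    ext <;> simp only <;> rcases hi with rfl | rfl <;> rcases hi' with rfl | rfl <;> omega
  have hpos := eisensteinNorm_pos hne
  omega

lemma pair_vertex_nonpos (Δ : Triangle) (m n : ℤ) : Δ.pair (vertex m n) ≤ 0 := by
  have h := height_nonneg ⟨Δ.x - m, Δ.y - n, Δ.i, Δ.hi⟩
  have h2 : Δ.pair (vertex m n) = -height ⟨Δ.x - m, Δ.y - n, Δ.i, Δ.hi⟩ := by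
    simp only [pair, vertex, height, eisensteinNorm]
    ring
  omega

end Triangle

/-- The orbit of the circles of the grid under the reflections in the incircles. -/
inductive Orbit : LatticeVector → Prop
  | of_vertex (m n : ℤ) : Orbit (vertex m n)
  | of_reflect (Δ : Triangle) {D : LatticeVector} : Orbit D → Orbit (Δ.reflect D)

/-- The vectors reached from the grid by reflections that move a circle from the outside of an
incircle to its inside. -/
inductive ReducedOrbit : LatticeVector → Prop
  | of_vertex (m n : ℤ) : ReducedOrbit (vertex m n)
  | of_reflect (Δ : Triangle) {D : LatticeVector} : Δ.pair D < 0 → ReducedOrbit D →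
      ReducedOrbit (Δ.reflect D)

/-- `D` lies inside the incircle of `Δ`, and is at least as far outside of all other incircles. -/
def InsideOf (Δ : Triangle) (D : LatticeVector) : Prop :=
  0 < Δ.pair D ∧ ∀ Δ' ≠ Δ, Δ'.pair D ≤ -Δ.pair D

/-- The ping-pong argument: a circle of the reduced orbit that is not in the grid lies inside
exactly one incircle, and it got there by the last reflection. -/
lemma ReducedOrbit.vertex_or_insideOf {D : LatticeVector} (hD : ReducedOrbit D) :
    (∃ m n, D = vertex m n) ∨
      ∃ Δ : Triangle, InsideOf Δ D ∧ ReducedOrbit (Δ.reflect D) := by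
  induction hD with
  | of_vertex m n => exact Or.inl ⟨m, n, rfl⟩
  | @of_reflect Δ D hneg hD ih =>
    refine Or.inr ⟨Δ, ⟨by rw [Δ.pair_reflect_self]; omega, fun Δ' hne => ?_⟩,
      by rwa [Δ.reflect_reflect]⟩
    rw [Δ.pair_reflect_self, Δ.pair_reflect]
    have hle := Triangle.pair_root_le hne.symm
    -- `Δ'.pair D ≤ max 0 (-Δ.pair D)`, and the reflection lowers it by at least `-2 Δ.pair D`.
    have hb : Δ'.pair D ≤ -Δ.pair D := by
      rcases ih with ⟨m, n, rfl⟩ | ⟨Δ₀, ⟨hpos, hother⟩, -⟩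
      · have := Δ'.pair_vertex_nonpos m n
        omega
      · have hne0 : Δ ≠ Δ₀ := by rintro rfl; omega
        have h1 := hother Δ hne0
        by_cases h : Δ' = Δ₀
        · subst h; omega
        · have := hother Δ' h
          omega
    nlinarith

lemma Orbit.reducedOrbit {D : LatticeVector} (hD : Orbit D) : ReducedOrbit D := by
  induction hD with
  | of_vertex m n => exact .of_vertex m n
  | @of_reflect Δ D _ ih =>
    rcases lt_trichotomy (Δ.pair D) 0 with h | h | h
    · exact .of_reflect Δ h ih
    · rwa [Triangle.reflect_eq_self h]
    · rcases ih.vertex_or_insideOf with ⟨m, n, rfl⟩ | ⟨Δ₀, ⟨hpos, hother⟩, hr⟩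
      · have := Δ.pair_vertex_nonpos m n
        omega
      · by_cases hΔ : Δ = Δ₀
        · rwa [hΔ]
        · have := hother Δ hΔ
          omega

lemma ReducedOrbit.f_nonneg {D : LatticeVector} (hD : ReducedOrbit D) : 0 ≤ D.f := by
  induction hD with
  | of_vertex m n => exact eisensteinNorm_nonneg m n
  | @of_reflect Δ D hneg _ ih =>
    have := Δ.height_nonneg
    simp only [Triangle.reflect, Triangle.root]
    nlinarith

/-- The vector whose sum with `vertex 0 0` is the null vector with `f = |ξ|²`, `e = 2 f` and
`m + n ω = s ξ²`, where `ξ = x + y ω` and `s = ±1`. -/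
def tangentVector (s x y : ℤ) : LatticeVector :=
  ⟨2 * eisensteinNorm x y - 1, eisensteinNorm x y, s * (x ^ 2 - y ^ 2), s * (2 * x * y + y ^ 2)⟩

lemma Triangle.reflect_tangentVector {Δ : Triangle} (hΔ : Δ.height = 0) {s : ℤ}
    (hs : s = 1 ∨ s = -1) (x y : ℤ) :
    ∃ x' y', Δ.reflect (tangentVector s x y) = tangentVector s x' y' := by
  obtain ⟨x₀, y₀, i, hi⟩ := Δ
  have hcases : (x₀ = 0 ∧ y₀ = 0) ∨ (x₀ = -i ∧ y₀ = 0) ∨ (x₀ = 0 ∧ y₀ = -i) := by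
    have hsq : i ^ 2 = 1 := by rcases hi with rfl | rfl <;> norm_num
    simp only [height, eisensteinNorm] at hΔ
    -- `height = 0` says that `3 (x₀, y₀) + (i, i)` lies on the ellipse of norm `3`.
    have hx : (3 * x₀ + i) ^ 2 ≤ 4 := by nlinarith [sq_nonneg (3 * x₀ + i + 2 * (3 * y₀ + i))]
    have hy : (3 * y₀ + i) ^ 2 ≤ 4 := by nlinarith [sq_nonneg (3 * y₀ + i + 2 * (3 * x₀ + i))]
    have hx1 := abs_le_of_sq_le_sq' (a := 3 * x₀ + i) (b := 2) (by linarith) (by norm_num)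
    have hy1 := abs_le_of_sq_le_sq' (a := 3 * y₀ + i) (b := 2) (by linarith) (by norm_num)
    have hx2 : x₀ = 0 ∨ x₀ = -i := by rcases hi with rfl | rfl <;> omega
    have hy2 : y₀ = 0 ∨ y₀ = -i := by rcases hi with rfl | rfl <;> omega
    rcases hx2 with rfl | rfl <;> rcases hy2 with rfl | rfl
    · simp
    · simp
    · simp
    · nlinarith
  rcases hs with rfl | rfl <;> rcases hi with rfl | rfl <;>
    rcases hcases with ⟨rfl, rfl⟩ | ⟨rfl, rfl⟩ | ⟨rfl, rfl⟩
  on_goal 1 => use -x + 2 * y, y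
  on_goal 2 => use -x, 4 * x + y
  on_goal 3 => use -3 * x - 4 * y, 2 * x + 3 * y
  on_goal 4 => use -3 * x - 2 * y, 4 * x + 3 * y
  on_goal 5 => use -x - 4 * y, y
  on_goal 6 => use -x, -2 * x + y
  on_goal 7 => use -3 * x - 2 * y, 4 * x + 3 * y
  on_goal 8 => use -x - 4 * y, y
  on_goal 9 => use -x, -2 * x + y
  on_goal 10 => use -x + 2 * y, y
  on_goal 11 => use -x, 4 * x + y
  on_goal 12 => use -3 * x - 4 * y, 2 * x + 3 * y
  all_goals
    ext <;> simp [reflect, root, pair, height, tangentVector, eisensteinNorm] <;> ring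

lemma inner_vertex_zero (D : LatticeVector) : inner (vertex 0 0) D = D.e - 2 * D.f := by
  simp [inner, vertex, eisensteinNorm]
  ring

/-- The circles of the packing other than `vertex 0 0` have inversive product at most `-1` with it,
and those that are tangent to it come from its six neighbors in the grid by reflections in the six
incircles around it; hence their parametrization. -/
lemma ReducedOrbit.eq_or_inner_le {D : LatticeVector} (hD : ReducedOrbit D) :
    D = vertex 0 0 ∨ inner (vertex 0 0) D ≤ -1 ∧
      (inner (vertex 0 0) D = -1 →
        ∃ s x y, (s = 1 ∨ s = -1) ∧ D = tangentVector s x y) := by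
  simp only [inner_vertex_zero]
  induction hD with
  | of_vertex m n =>
    by_cases h0 : m = 0 ∧ n = 0
    · left; rw [h0.1, h0.2]
    right
    have hpos : 0 < eisensteinNorm m n := eisensteinNorm_pos (by tauto)
    simp only [vertex]
    refine ⟨by omega, fun h => ?_⟩
    have h1 : eisensteinNorm m n = 1 := by omega
    simp only [eisensteinNorm] at h1
    have hm : m ^ 2 ≤ 1 := by nlinarith [sq_nonneg (m + 2 * n)]
    have hn : n ^ 2 ≤ 1 := by nlinarith [sq_nonneg (n + 2 * m)]
    have hm1 := abs_le_of_sq_le_sq' (a := m) (b := 1) (by linarith) (by norm_num)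
    have hn1 := abs_le_of_sq_le_sq' (a := n) (b := 1) (by linarith) (by norm_num)
    have hm2 : m = -1 ∨ m = 0 ∨ m = 1 := by omega
    have hn2 : n = -1 ∨ n = 0 ∨ n = 1 := by omega
    rcases hm2 with rfl | rfl | rfl <;> rcases hn2 with rfl | rfl | rfl <;> norm_num at h1
    · exact ⟨-1, 1, 0, by simp, by simp [tangentVector, eisensteinNorm]⟩
    · exact ⟨1, 0, 1, by simp, by simp [tangentVector, eisensteinNorm]⟩
    · exact ⟨1, 1, -1, by simp, by simp [tangentVector, eisensteinNorm]⟩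
    · exact ⟨-1, 1, -1, by simp, by simp [tangentVector, eisensteinNorm]⟩
    · exact ⟨-1, 0, 1, by simp, by simp [tangentVector, eisensteinNorm]⟩
    · exact ⟨1, 1, 0, by simp, by simp [tangentVector, eisensteinNorm]⟩
  | @of_reflect Δ D hneg hD' ih =>
    right
    have hh := Δ.height_nonneg
    have key : (Δ.reflect D).e - 2 * (Δ.reflect D).f
        = D.e - 2 * D.f + 24 * Δ.height * Δ.pair D := by
      simp only [Triangle.reflect, Triangle.root]
      ring
    rw [key]
    rcases ih with rfl | ⟨hle, htan⟩
    · have hp : Δ.pair (vertex 0 0) = -Δ.height := by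
        simp [Triangle.pair, vertex, eisensteinNorm]
      rw [hp] at hneg ⊢
      simp only [vertex, eisensteinNorm]
      constructor <;> intros <;> nlinarith
    · refine ⟨by nlinarith, fun heq => ?_⟩
      have h0 : Δ.height = 0 := by
        by_contra hne
        have : 1 ≤ Δ.height := by omega
        nlinarith
      rw [h0] at heq
      obtain ⟨s, x, y, hs, rfl⟩ := htan (by omega)
      obtain ⟨x', y', h⟩ := Triangle.reflect_tangentVector h0 hs x y
      exact ⟨s, x', y', hs, h⟩

/-! ### Curvature forms -/

/-- The linear forms on the lattice that are given by the product with a null vector. The curvatures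
of a triangular packing are the values of such a form on the orbit of the grid. -/
structure NullForm where
  A : ℤ
  k : ℤ
  U : ℤ
  W : ℤ
  null : 3 * k * (2 * A + k) = U ^ 2 - U * W + W ^ 2

namespace NullForm

/-- The value of the form at a lattice vector. -/
def eval (l : NullForm) (D : LatticeVector) : ℤ :=
  l.A * D.e + 2 * l.k * D.f + l.U * D.m + l.W * D.n

/-- The curvature of `vertex 0 0`. -/
def a (l : NullForm) : ℤ := l.eval (vertex 0 0)

/-- The curvature of `vertex 1 0`. -/
def b (l : NullForm) : ℤ := l.eval (vertex 1 0)

/-- The curvature of `vertex 0 1`. -/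
def c (l : NullForm) : ℤ := l.eval (vertex 0 1)

/-- The integer `t` with `3 t ^ 2 = a b + b c + c a`. The four integers `a, b, c, t` determine the
form. -/
def t (l : NullForm) : ℤ := -(l.A + l.k + (l.U + l.W) / 3)

lemma a_eq (l : NullForm) : l.a = l.A := by simp [a, eval, vertex, eisensteinNorm]

lemma b_eq (l : NullForm) : l.b = l.A + 2 * l.k + l.U := by
  simp [b, eval, vertex, eisensteinNorm]

lemma c_eq (l : NullForm) : l.c = l.A + 2 * l.k + l.W := by
  simp [c, eval, vertex, eisensteinNorm]

lemma three_dvd (l : NullForm) : 3 ∣ l.U + l.W := by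
  have h : (3 : ℤ) ∣ (l.U + l.W) ^ 2 :=
    ⟨l.k * (2 * l.A + l.k) + l.U * l.W, by linear_combination -l.null⟩
  exact Int.prime_three.dvd_of_dvd_pow h

lemma three_mul_t (l : NullForm) : 3 * l.t = l.k - l.a - l.b - l.c := by
  have h := l.three_dvd
  rw [a_eq, b_eq, c_eq, t]
  omega

lemma k_eq (l : NullForm) : l.k = l.a + l.b + l.c + 3 * l.t := by
  rw [three_mul_t]; ring

lemma descartes (l : NullForm) : 3 * l.t ^ 2 = l.a * l.b + l.b * l.c + l.c * l.a := by
  have h := l.three_mul_t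
  have hn := l.null
  rw [a_eq, b_eq, c_eq] at *
  have : 3 * (3 * l.t ^ 2)
      = 3 * (l.A * (l.A + 2 * l.k + l.U) + (l.A + 2 * l.k + l.U) * (l.A + 2 * l.k + l.W)
        + (l.A + 2 * l.k + l.W) * l.A) := by
    linear_combination (3 * l.t + (l.k - l.A - (l.A + 2 * l.k + l.U) - (l.A + 2 * l.k + l.W))) * h
      - hn
  linarith

/-- With `C` the circle at the origin of the grid, of curvature `a`, the numbers `ρ = a + b` for
the circles tangent to `C` are values of two binary quadratic forms of discriminant `-12 a ^ 2`,
each equivalent over `ℤ[1/3]` to `3` times the other. Composition gives the product of any two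
values. -/
lemma mul_eq_of_tangent (l : NullForm) {D D' : LatticeVector} (hD : Orbit D) (hD' : Orbit D')
    (h : inner (vertex 0 0) D = -1) (h' : inner (vertex 0 0) D' = -1) :
    ∃ B κ : ℤ, (l.a + l.eval D) * (l.a + l.eval D') = B ^ 2 + 3 * l.a ^ 2 * κ ^ 2 ∨
      (l.a + l.eval D) * (l.a + l.eval D') = 3 * B ^ 2 + l.a ^ 2 * κ ^ 2 := by
  have key : ∀ D, Orbit D → inner (vertex 0 0) D = -1 →
      ∃ s x y, (s = 1 ∨ s = -1) ∧ D = tangentVector s x y := by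
    intro D hD h
    rcases hD.reducedOrbit.eq_or_inner_le with rfl | h1
    · simp [inner, vertex, eisensteinNorm] at h
    · exact h1.2 h
  obtain ⟨s, x, y, hs, rfl⟩ := key D hD h
  obtain ⟨s', x', y', hs', rfl⟩ := key D' hD' h'
  have hn := l.null
  obtain ⟨r, hr⟩ := l.three_dvd
  obtain hW : l.W = 3 * r - l.U := by linarith
  rw [a_eq]
  have e1 : ∀ s x y, l.A + l.eval (tangentVector s x y)
      = 2 * (l.A + l.k) * (x ^ 2 + x * y + y ^ 2)
        + s * (l.U * (x ^ 2 - y ^ 2) + l.W * (2 * x * y + y ^ 2)) := by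
    intro s x y
    simp only [eval, tangentVector, eisensteinNorm]
    ring
  -- the mixed case, where the second argument is multiplied by `√-3`
  have mixed : ∀ x y x' y', ∃ B κ : ℤ,
      (l.A + l.eval (tangentVector 1 x y)) * (l.A + l.eval (tangentVector (-1) x' y'))
        = 3 * B ^ 2 + l.A ^ 2 * κ ^ 2 := by
    intro x y x' y'
    refine ⟨(2 * r - l.U) * x * x' + (r - l.U - (l.A + l.k)) * x * y'
      + (l.A + l.k - l.U + r) * x' * y - r * y * y', 2 * x * x' + x * y' + y * x' + 2 * y * y', ?_⟩
    rw [e1, e1, hW]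
    have hn' : l.k * (2 * l.A + l.k) = l.U ^ 2 - 3 * l.U * r + 3 * r ^ 2 := by
      rw [hW] at hn
      linarith
    linear_combination (2 * x * x' + x * y' + y * x' + 2 * y * y') ^ 2 * hn'
  have same : ∀ s x y x' y', (s = 1 ∨ s = -1) → ∃ B κ : ℤ,
      (l.A + l.eval (tangentVector s x y)) * (l.A + l.eval (tangentVector s x' y'))
        = B ^ 2 + 3 * l.A ^ 2 * κ ^ 2 := by
    intro s x y x' y' hs
    refine ⟨(2 * (l.A + l.k) + s * l.U) * x * x' + (l.A + l.k + s * l.W) * (x * y' + x' * y)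
      + (2 * (l.A + l.k) - s * l.U + s * l.W) * y * y', x * y' - x' * y, ?_⟩
    rw [e1, e1]
    rcases hs with rfl | rfl <;> linear_combination (x * y' - x' * y) ^ 2 * hn
  rcases hs with rfl | rfl <;> rcases hs' with rfl | rfl
  · obtain ⟨B, κ, h⟩ := same 1 x y x' y' (by simp)
    exact ⟨B, κ, Or.inl h⟩
  · obtain ⟨B, κ, h⟩ := mixed x y x' y'
    exact ⟨B, κ, Or.inr h⟩
  · obtain ⟨B, κ, h⟩ := mixed x' y' x y
    exact ⟨B, κ, Or.inr (by rw [mul_comm, h])⟩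
  · obtain ⟨B, κ, h⟩ := same (-1) x y x' y' (by simp)
    exact ⟨B, κ, Or.inl h⟩

end NullForm

/-! ### Symmetries -/

/-- A symmetry of the configuration. Null forms pull back to null forms along it, and it has a
right inverse that preserves the orbit. -/
structure IsSymmetry (φ : LatticeVector → LatticeVector) : Prop where
  orbit : ∀ D, Orbit D → Orbit (φ D)
  inner_eq : ∀ C D, inner (φ C) (φ D) = inner C D
  exists_inv : ∃ ψ : LatticeVector → LatticeVector,
    (∀ D, Orbit D → Orbit (ψ D)) ∧ ∀ D, φ (ψ D) = D
  pull : ∀ l : NullForm, ∃ l' : NullForm, ∀ D, l'.eval D = l.eval (φ D)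

lemma IsSymmetry.id : IsSymmetry id where
  orbit _ h := h
  inner_eq _ _ := rfl
  exists_inv := ⟨_root_.id, fun _ h => h, fun _ => rfl⟩
  pull l := ⟨l, fun _ => rfl⟩

lemma IsSymmetry.comp {φ ψ : LatticeVector → LatticeVector} (hφ : IsSymmetry φ)
    (hψ : IsSymmetry ψ) : IsSymmetry (φ ∘ ψ) where
  orbit D h := hφ.orbit _ (hψ.orbit _ h)
  inner_eq C D := by simp [hφ.inner_eq, hψ.inner_eq]
  exists_inv := by
    obtain ⟨φ', h1, h2⟩ := hφ.exists_inv
    obtain ⟨ψ', h3, h4⟩ := hψ.exists_inv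
    exact ⟨ψ' ∘ φ', fun D h => h3 _ (h1 _ h), fun D => by simp [h2, h4]⟩
  pull l := by
    obtain ⟨l₁, h₁⟩ := hφ.pull l
    obtain ⟨l₂, h₂⟩ := hψ.pull l₁
    exact ⟨l₂, fun D => by simp [h₁, h₂]⟩

/-- A map of the lattice that permutes the grid and intertwines the reflections in the incircles
preserves the orbit. -/
lemma Orbit.map {φ : LatticeVector → LatticeVector}
    (h1 : ∀ m n, ∃ m' n', φ (vertex m n) = vertex m' n')
    (h2 : ∀ Δ : Triangle, ∃ Δ' : Triangle, ∀ D, φ (Δ.reflect D) = Δ'.reflect (φ D))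
    (D : LatticeVector) (hD : Orbit D) : Orbit (φ D) := by
  induction hD with
  | of_vertex m n =>
    obtain ⟨m', n', h⟩ := h1 m n
    rw [h]
    exact .of_vertex m' n'
  | @of_reflect Δ D _ ih =>
    obtain ⟨Δ', h⟩ := h2 Δ
    rw [h]
    exact .of_reflect Δ' ih

lemma Triangle.isSymmetry_reflect (Δ : Triangle) : IsSymmetry Δ.reflect where
  orbit _ h := .of_reflect Δ h
  inner_eq C D := by
    obtain ⟨x, y, i, hi⟩ := Δ
    rcases hi with rfl | rfl <;>
      simp only [inner, reflect, pair, root, height, eisensteinNorm] <;> ring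
  exists_inv := ⟨Δ.reflect, fun _ h => .of_reflect Δ h, Δ.reflect_reflect⟩
  pull l := by
    have h := l.null
    refine ⟨⟨l.A + l.eval Δ.root * Δ.height, l.k + (6 * l.A + 6 * l.k + 12 * l.k * Δ.height
      + 2 * l.U * (3 * Δ.x + Δ.i) + 2 * l.W * (3 * Δ.y + Δ.i)),
      l.U - l.eval Δ.root * (2 * Δ.x + Δ.y + Δ.i),
      l.W - l.eval Δ.root * (Δ.x + 2 * Δ.y + Δ.i), ?_⟩, fun D => ?_⟩
    · obtain ⟨x, y, i, hi⟩ := Δ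
      rcases hi with rfl | rfl <;> simp only [NullForm.eval, root, height, eisensteinNorm] <;>
        linear_combination h
    · simp only [NullForm.eval, reflect, pair, root, height, eisensteinNorm]
      ring

/-- The translation of the grid that moves `vertex 0 0` to `vertex x y`. -/
def translate (x y : ℤ) (D : LatticeVector) : LatticeVector :=
  ⟨D.e, D.f + D.m * (2 * x + y) + D.n * (x + 2 * y) + D.e * eisensteinNorm x y, D.m + D.e * x,
    D.n + D.e * y⟩

lemma orbit_translate (x y : ℤ) (D : LatticeVector) (hD : Orbit D) : Orbit (translate x y D) := by
  refine Orbit.map (fun m n => ⟨m + x, n + y, ?_⟩)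
    (fun Δ => ⟨⟨Δ.x + x, Δ.y + y, Δ.i, Δ.hi⟩, fun D => ?_⟩) D hD
  · ext <;> simp only [translate, vertex, eisensteinNorm] <;> ring
  · ext <;> simp only [translate, Triangle.reflect, Triangle.pair, Triangle.root, Triangle.height,
      eisensteinNorm] <;> ring

lemma isSymmetry_translate (x y : ℤ) : IsSymmetry (translate x y) where
  orbit := orbit_translate x y
  inner_eq C D := by simp only [inner, translate, eisensteinNorm]; ring
  exists_inv := ⟨translate (-x) (-y), orbit_translate _ _, fun D => by
    ext <;> simp only [translate, eisensteinNorm] <;> ring⟩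
  pull l := by
    have h := l.null
    refine ⟨⟨l.A + 2 * l.k * eisensteinNorm x y + l.U * x + l.W * y, l.k,
      l.U + 2 * l.k * (2 * x + y), l.W + 2 * l.k * (x + 2 * y), ?_⟩, fun D => ?_⟩
    · simp only [eisensteinNorm]
      linear_combination h
    · simp only [NullForm.eval, translate]
      ring

/-- The reflection of the grid that exchanges `vertex 1 0` and `vertex 0 1` and fixes
`vertex 0 0`. -/
def swapBC (D : LatticeVector) : LatticeVector := ⟨D.e, D.f, D.n, D.m⟩

/-- The reflection of the grid that exchanges `vertex 0 0` and `vertex 1 0` and fixes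
`vertex 0 1`. -/
def swapAB (D : LatticeVector) : LatticeVector :=
  ⟨D.e, D.f + D.e - 2 * D.m - D.n, D.e - D.m - D.n, D.n⟩

/-- The reflection of the grid in the line through `vertex 0 0` and `vertex 1 0`. -/
def mirror (D : LatticeVector) : LatticeVector := ⟨D.e, D.f, D.m + D.n, -D.n⟩

lemma isSymmetry_swapBC : IsSymmetry swapBC := by
  have ho : ∀ D, Orbit D → Orbit (swapBC D) := by
    refine Orbit.map (fun m n => ⟨n, m, ?_⟩) (fun Δ => ⟨⟨Δ.y, Δ.x, Δ.i, Δ.hi⟩, fun D => ?_⟩)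
    · ext <;> simp only [swapBC, vertex, eisensteinNorm]
      ring
    · ext <;> simp only [swapBC, Triangle.reflect, Triangle.pair, Triangle.root, Triangle.height,
        eisensteinNorm] <;> ring
  refine ⟨ho, fun C D => ?_, ⟨swapBC, ho, fun D => rfl⟩, fun l => ?_⟩
  · simp only [inner, swapBC]; ring
  · refine ⟨⟨l.A, l.k, l.W, l.U, by linear_combination l.null⟩, fun D => ?_⟩
    simp only [NullForm.eval, swapBC]; ring

lemma isSymmetry_swapAB : IsSymmetry swapAB := by
  have ho : ∀ D, Orbit D → Orbit (swapAB D) := by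
    refine Orbit.map (fun m n => ⟨1 - m - n, n, ?_⟩)
      (fun Δ => ⟨⟨1 - Δ.x - Δ.y - Δ.i, Δ.y, Δ.i, Δ.hi⟩, fun D => ?_⟩)
    · ext <;> simp only [swapAB, vertex, eisensteinNorm]
      ring
    · obtain ⟨x, y, i, hi⟩ := Δ
      rcases hi with rfl | rfl <;> ext <;>
        simp only [swapAB, Triangle.reflect, Triangle.pair, Triangle.root, Triangle.height,
          eisensteinNorm] <;> ring
  refine ⟨ho, fun C D => ?_, ⟨swapAB, ho, fun D => ?_⟩, fun l => ?_⟩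
  · simp only [inner, swapAB]; ring
  · ext <;> simp only [swapAB] <;> ring
  · refine ⟨⟨l.A + 2 * l.k + l.U, l.k, -4 * l.k - l.U, -2 * l.k - l.U + l.W, ?_⟩, fun D => ?_⟩
    · linear_combination l.null
    · simp only [NullForm.eval, swapAB]; ring

lemma isSymmetry_mirror : IsSymmetry mirror := by
  have ho : ∀ D, Orbit D → Orbit (mirror D) := by
    refine Orbit.map (fun m n => ⟨m + n, -n, ?_⟩)
      (fun Δ => ⟨⟨Δ.x + Δ.y + Δ.i, -Δ.y, -Δ.i, by have := Δ.hi; omega⟩, fun D => ?_⟩)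
    · ext <;> simp only [mirror, vertex, eisensteinNorm]
      ring
    · obtain ⟨x, y, i, hi⟩ := Δ
      rcases hi with rfl | rfl <;> ext <;>
        simp only [mirror, Triangle.reflect, Triangle.pair, Triangle.root, Triangle.height,
          eisensteinNorm] <;> ring
  refine ⟨ho, fun C D => ?_, ⟨mirror, ho, fun D => ?_⟩, fun l => ?_⟩
  · simp only [inner, mirror]; ring
  · ext <;> simp only [mirror] <;> ring
  · refine ⟨⟨l.A, l.k, l.U, l.U - l.W, by linear_combination l.null⟩, fun D => ?_⟩
    simp only [NullForm.eval, mirror]; ring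

/-- Every circle of the orbit is the image of `vertex 0 0` under a symmetry. -/
lemma Orbit.exists_isSymmetry {C : LatticeVector} (hC : Orbit C) :
    ∃ φ, IsSymmetry φ ∧ φ (vertex 0 0) = C := by
  induction hC with
  | of_vertex m n =>
    refine ⟨translate m n, isSymmetry_translate m n, ?_⟩
    ext <;> simp [translate, vertex, eisensteinNorm]
  | @of_reflect Δ D _ ih =>
    obtain ⟨φ, hφ, rfl⟩ := ih
    exact ⟨Δ.reflect ∘ φ, Δ.isSymmetry_reflect.comp hφ, rfl⟩

/-- The up-pointing triangle with vertices `vertex 0 0`, `vertex 1 0`, `vertex 0 1`. -/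
def baseTriangle : Triangle := ⟨0, 0, 1, Or.inl rfl⟩

namespace NullForm

variable {l l' : NullForm}

lemma k_of_pull {φ : LatticeVector → LatticeVector} (h : ∀ D, l'.eval D = l.eval (φ D)) :
    2 * l'.k = l.eval (φ ⟨0, 1, 0, 0⟩) := by
  rw [← h]; simp [eval]

/-- The effect of a symmetry on `t` is determined by its effect on `k`. -/
lemma t_of_k {s : ℤ} (h : l'.k = l'.a + l'.b + l'.c + 3 * s) : l'.t = s := by
  have := l'.three_mul_t
  omega

lemma pull_swapBC (h : ∀ D, l'.eval D = l.eval (swapBC D)) :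
    l'.a = l.a ∧ l'.b = l.c ∧ l'.c = l.b ∧ l'.t = l.t := by
  have ha : l'.a = l.a := by rw [a, h]; rfl
  have hb : l'.b = l.c := by rw [b, h]; rfl
  have hc : l'.c = l.b := by rw [c, h]; rfl
  refine ⟨ha, hb, hc, t_of_k ?_⟩
  have h1 := k_of_pull h
  have h2 := l.k_eq
  simp [eval, swapBC] at h1
  rw [h1, h2, ha, hb, hc]; ring

lemma pull_swapAB (h : ∀ D, l'.eval D = l.eval (swapAB D)) :
    l'.a = l.b ∧ l'.b = l.a ∧ l'.c = l.c ∧ l'.t = l.t := by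
  have ha : l'.a = l.b := by rw [a, h]; rfl
  have hb : l'.b = l.a := by rw [b, h]; rfl
  have hc : l'.c = l.c := by rw [c, h]; rfl
  refine ⟨ha, hb, hc, t_of_k ?_⟩
  have h1 := k_of_pull h
  have h2 := l.k_eq
  simp [eval, swapAB] at h1
  rw [h1, h2, ha, hb, hc]; ring

lemma pull_mirror (h : ∀ D, l'.eval D = l.eval (mirror D)) :
    l'.a = l.a ∧ l'.b = l.b ∧ l'.c = l.c + 6 * l.t + 3 * (l.a + l.b) ∧
      l'.t = -l.t - (l.a + l.b) := by
  have h2 := l.k_eq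
  have ha : l'.a = l.a := by rw [a, h]; rfl
  have hb : l'.b = l.b := by rw [b, h]; rfl
  have hc : l'.c = l.c + 6 * l.t + 3 * (l.a + l.b) := by
    have e1 := l.a_eq
    have e2 := l.b_eq
    have e3 := l.c_eq
    rw [c, h]
    simp [eval, mirror, vertex, eisensteinNorm]
    linarith
  refine ⟨ha, hb, hc, t_of_k ?_⟩
  have h1 := k_of_pull h
  simp [eval, mirror] at h1
  rw [h1, h2, ha, hb, hc]; ring

lemma pull_reflect (h : ∀ D, l'.eval D = l.eval (baseTriangle.reflect D)) :
    l'.a = l.a ∧ l'.b = l.b ∧ l'.c = l.c ∧ l'.t = -l.t := by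
  have h2 := l.k_eq
  have ha : l'.a = l.a := by
    rw [a, h, Triangle.reflect_eq_self (by decide)]; rfl
  have hb : l'.b = l.b := by
    rw [b, h, Triangle.reflect_eq_self (by decide)]; rfl
  have hc : l'.c = l.c := by
    rw [c, h, Triangle.reflect_eq_self (by decide)]; rfl
  refine ⟨ha, hb, hc, t_of_k ?_⟩
  have h1 := k_of_pull h
  have e1 := l.a_eq
  have e2 := l.b_eq
  have e3 := l.c_eq
  simp [eval, Triangle.reflect, Triangle.pair, Triangle.root, Triangle.height, baseTriangle,
    eisensteinNorm] at h1
  rw [ha, hb, hc]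
  linarith

/-- The circles tangent to both `vertex 0 0` and `vertex 1 0` form a chain, whose curvatures are the
values of a quadratic polynomial. It is an orbit of the parabolic symmetry
`mirror ∘ baseTriangle.reflect`, which fixes both circles. -/
lemma exists_chain (l : NullForm) (j : ℤ) : ∃ φ, IsSymmetry φ ∧ φ (vertex 0 0) = vertex 0 0 ∧
    φ (vertex 1 0) = vertex 1 0 ∧ ∃ l' : NullForm, (∀ D, l'.eval D = l.eval (φ D)) ∧
      l'.a = l.a ∧ l'.b = l.b ∧ l'.c = l.c + 6 * l.t * j + 3 * (l.a + l.b) * j ^ 2 ∧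
      l'.t = l.t + (l.a + l.b) * j := by
  have hm0 : mirror (vertex 0 0) = vertex 0 0 := rfl
  have hm1 : mirror (vertex 1 0) = vertex 1 0 := rfl
  have hr0 : baseTriangle.reflect (vertex 0 0) = vertex 0 0 :=
    Triangle.reflect_eq_self (by decide)
  have hr1 : baseTriangle.reflect (vertex 1 0) = vertex 1 0 :=
    Triangle.reflect_eq_self (by decide)
  induction j with
  | zero => exact ⟨id, .id, rfl, rfl, l, fun _ => rfl, rfl, rfl, by ring, by ring⟩
  | succ j ih =>
    obtain ⟨φ, hφ, h0, h1, l₁, hl, ha, hb, hc, ht⟩ := ih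
    obtain ⟨l₂, h₂⟩ := isSymmetry_mirror.pull l₁
    obtain ⟨l₃, h₃⟩ := baseTriangle.isSymmetry_reflect.pull l₂
    obtain ⟨a2, b2, c2, t2⟩ := pull_mirror h₂
    obtain ⟨a3, b3, c3, t3⟩ := pull_reflect h₃
    refine ⟨φ ∘ (mirror ∘ baseTriangle.reflect),
      hφ.comp (isSymmetry_mirror.comp baseTriangle.isSymmetry_reflect), ?_, ?_, l₃,
      fun D => by rw [h₃, h₂, hl]; rfl, ?_, ?_, ?_, ?_⟩
    · simp [hr0, hm0, h0]
    · simp [hr1, hm1, h1]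
    · rw [a3, a2, ha]
    · rw [b3, b2, hb]
    · rw [c3, c2, ha, hb, hc, ht]; ring
    · rw [t3, t2, ha, hb, ht]; ring
  | pred j ih =>
    obtain ⟨φ, hφ, h0, h1, l₁, hl, ha, hb, hc, ht⟩ := ih
    obtain ⟨l₂, h₂⟩ := baseTriangle.isSymmetry_reflect.pull l₁
    obtain ⟨l₃, h₃⟩ := isSymmetry_mirror.pull l₂
    obtain ⟨a2, b2, c2, t2⟩ := pull_reflect h₂
    obtain ⟨a3, b3, c3, t3⟩ := pull_mirror h₃
    refine ⟨φ ∘ (baseTriangle.reflect ∘ mirror),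
      hφ.comp (baseTriangle.isSymmetry_reflect.comp isSymmetry_mirror), ?_, ?_, l₃,
      fun D => by rw [h₃, h₂, hl]; rfl, ?_, ?_, ?_, ?_⟩
    · simp [hr0, hm0, h0]
    · simp [hr1, hm1, h1]
    · rw [a3, a2, ha]
    · rw [b3, b2, hb]
    · rw [c3, c2, a2, b2, t2, ha, hb, hc, ht]; ring
    · rw [t3, t2, a2, b2, ha, hb, ht]; ring

/-- Modulo `3` the curvatures of a packing are those of the base triangle. -/
lemma eval_modEq_three (l : NullForm) {D : LatticeVector} (hD : Orbit D) :
    3 ∣ l.eval D - l.a ∨ 3 ∣ l.eval D - l.b ∨ 3 ∣ l.eval D - l.c := by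
  obtain ⟨r, hr⟩ := l.three_dvd
  have hW : l.W = 3 * r - l.U := by linarith
  induction hD with
  | of_vertex m n =>
    rw [a_eq, b_eq, c_eq]
    simp only [eval, vertex, eisensteinNorm, hW]
    -- the value depends on `m - n` modulo `3` only
    obtain ⟨q, hq | hq | hq⟩ : ∃ q, m - n = 3 * q ∨ m - n = 3 * q + 1 ∨ m - n = 3 * q + 2 :=
      ⟨(m - n) / 3, by omega⟩
    · left
      obtain rfl : m = n + 3 * q := by linarith
      exact ⟨2 * l.k * (n ^ 2 + 3 * n * q + 3 * q ^ 2) + l.U * q + r * n, by ring⟩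
    · right; left
      obtain rfl : m = n + 3 * q + 1 := by linarith
      exact ⟨2 * l.k * (n ^ 2 + 3 * n * q + n + 3 * q ^ 2 + 2 * q) + l.U * q + r * n, by ring⟩
    · right; right
      obtain rfl : m = n + 3 * q + 2 := by linarith
      exact ⟨2 * l.k * (n ^ 2 + 3 * n * q + 2 * n + 3 * q ^ 2 + 4 * q + 1) + l.U * (q + 1)
        + r * (n - 1), by ring⟩
  | @of_reflect Δ D _ ih =>
    have key : (3 : ℤ) ∣ l.eval (Δ.reflect D) - l.eval D := by
      refine ⟨-Δ.pair D * (4 * l.A + 4 * l.k * (1 + 2 * Δ.height) + 4 * l.U * (Δ.x - Δ.y)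
        + 4 * r * (3 * Δ.y + Δ.i)), ?_⟩
      simp only [eval, Triangle.reflect, Triangle.root, hW]
      ring
    omega

end NullForm

/-! ### The symbol at a single circle and at a tangent pair -/

lemma kroneckerSymbol_eq_jacobiSym {a ρ : ℤ} (hρ : 0 < ρ) (ha : a % 2 = 1) :
    kroneckerSymbol ρ a = jacobiSym ρ a.natAbs := by
  have h2 : a.natAbs.factorization 2 = 0 :=
    Nat.factorization_eq_zero_of_not_dvd (by omega)
  simp [kroneckerSymbol, h2, not_lt.mpr hρ.le]

lemma jacobiSym_three {n : ℕ} (hn : n % 12 = 1 ∨ n % 12 = 11) : jacobiSym 3 n = 1 := by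
  rcases hn with hn | hn
  · have h := jacobiSym.quadratic_reciprocity_one_mod_four' (a := 3) (b := n) (by decide) (by omega)
    have h3 : ((n : ℤ) % (3 : ℕ)) = 1 := by push_cast; omega
    rw [jacobiSym.mod_left (n : ℤ) 3, h3] at h
    simpa using h
  · have h := jacobiSym.quadratic_reciprocity_three_mod_four (a := 3) (b := n) (by decide)
      (by omega)
    have h3 : ((n : ℤ) % (3 : ℕ)) = 2 := by push_cast; omega
    rw [jacobiSym.mod_left (n : ℤ) 3, h3] at h
    have h4 : jacobiSym 2 3 = -1 := by decide +kernel
    rw [h4] at h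
    simpa using h

lemma gcd_natAbs_eq_one {x a : ℤ} (h : IsCoprime x a) : x.gcd (a.natAbs : ℤ) = 1 := by
  rw [Int.isCoprime_iff_gcd_eq_one] at h
  simpa only [Int.gcd, Int.natAbs_natCast] using h

lemma jacobiSym_add_mul_self (a y z : ℤ) :
    jacobiSym (y + a * z) a.natAbs = jacobiSym y a.natAbs := by
  apply jacobiSym.mod_left'
  have h : (a.natAbs : ℤ) ∣ a * z := (Int.natAbs_dvd.mpr (dvd_refl a)).mul_right z
  exact Int.ModEq.symm (Int.modEq_iff_dvd.mpr (by rwa [add_sub_cancel_left]))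

/-- The congruence class of `ρ ρ'` modulo `a` makes the symbols of `ρ` and `ρ'` equal. -/
lemma chiTwoAt_eq_of_mul_eq {a ρ ρ' B κ : ℤ} (ha : a % 12 = 1 ∨ a % 12 = 3 ∨ a % 12 = 11)
    (hρ : 0 < ρ) (hρ' : 0 < ρ') (hc : IsCoprime ρ a) (hc' : IsCoprime ρ' a)
    (h : ρ * ρ' = B ^ 2 + 3 * a ^ 2 * κ ^ 2 ∨ ρ * ρ' = 3 * B ^ 2 + a ^ 2 * κ ^ 2) :
    chiTwoAt a ρ = chiTwoAt a ρ' := by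
  have hodd : a % 2 = 1 := by omega
  suffices hJ : jacobiSym ρ a.natAbs = jacobiSym ρ' a.natAbs by
    simp only [chiTwoAt, kroneckerSymbol_eq_jacobiSym hρ hodd,
      kroneckerSymbol_eq_jacobiSym hρ' hodd, hJ]
  have hmul : jacobiSym (ρ * ρ') a.natAbs = 1 := by
    have hcc : IsCoprime (ρ * ρ') a := hc.mul_left hc'
    rcases h with h | h
    · have h1 : ρ * ρ' = B ^ 2 + a * (3 * a * κ ^ 2) := by rw [h]; ring
      have hB : IsCoprime (B ^ 2) a := by
        rw [h1] at hcc
        exact (IsCoprime.add_mul_left_left_iff).mp hcc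
      rw [h1, jacobiSym_add_mul_self]
      exact jacobiSym.sq_one' (gcd_natAbs_eq_one (IsCoprime.pow_left_iff (by norm_num) |>.mp hB))
    · have h1 : ρ * ρ' = 3 * B ^ 2 + a * (a * κ ^ 2) := by rw [h]; ring
      have hB : IsCoprime (3 * B ^ 2) a := by
        rw [h1] at hcc
        exact (IsCoprime.add_mul_left_left_iff).mp hcc
      have h3 : IsCoprime 3 a := hB.of_mul_left_left
      have hB2 : IsCoprime B a :=
        IsCoprime.pow_left_iff (by norm_num) |>.mp hB.of_mul_left_right
      have hn3 : ¬ (3 : ℤ) ∣ a := fun hd => by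
        have := h3.isUnit_of_dvd' (dvd_refl 3) hd
        exact absurd this (by decide)
      rw [h1, jacobiSym_add_mul_self, jacobiSym.mul_left, jacobiSym_three (by omega),
        jacobiSym.sq_one' (gcd_natAbs_eq_one hB2), one_mul]
  rw [jacobiSym.mul_left] at hmul
  rcases jacobiSym.eq_one_or_neg_one (gcd_natAbs_eq_one hc) with h1 | h1 <;>
    rcases jacobiSym.eq_one_or_neg_one (gcd_natAbs_eq_one hc') with h2 | h2 <;>
    rw [h1, h2] at hmul <;> simp_all

lemma jacobiSym_add_self (a b : ℤ) : jacobiSym (a + b) a.natAbs = jacobiSym b a.natAbs := by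
  have h := jacobiSym_add_mul_self a b 1
  rwa [mul_one, add_comm] at h

lemma jacobiSym_add_self' (a b : ℤ) : jacobiSym (a + b) b.natAbs = jacobiSym a b.natAbs := by
  rw [add_comm, jacobiSym_add_self]

/-- Quadratic reciprocity at a tangent pair of curvatures `1` modulo `4`. The hypothesis
`0 < a + b` excludes that both are negative. -/
lemma jacobiSym_comm_of_one_mod_four {a b : ℤ} (ha : a % 4 = 1) (hb : b % 4 = 1)
    (hab : 0 < a + b) : jacobiSym b a.natAbs = jacobiSym a b.natAbs := by
  wlog hbpos : 0 < b generalizing a b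
  · exact (this hb ha (by omega) (by omega)).symm
  lift b to ℕ using hbpos.le
  simp only [Int.natAbs_natCast]
  rw [jacobiSym.quadratic_reciprocity_one_mod_four (by omega) (Nat.odd_iff.mpr (by omega))]
  rcases Int.natAbs_eq a with h | h
  · rw [← h]
  · conv_rhs => rw [h]
    rw [jacobiSym.neg _ (Nat.odd_iff.mpr (by omega)), ZMod.χ₄_nat_one_mod_four (by omega), one_mul]

/-- Quadratic reciprocity at a tangent pair of curvatures `3` modulo `4`. -/
lemma jacobiSym_comm_of_three_mod_four {a b : ℤ} (ha : a % 4 = 3) (hb : b % 4 = 3)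
    (hab : 0 < a + b) : jacobiSym b a.natAbs = -jacobiSym a b.natAbs := by
  wlog hbpos : 0 < b generalizing a b
  · rw [this hb ha (by omega) (by omega), neg_neg]
  lift b to ℕ using hbpos.le
  simp only [Int.natAbs_natCast]
  rcases Int.natAbs_eq a with h | h
  · rw [jacobiSym.quadratic_reciprocity_three_mod_four (by omega) (by omega), ← h]
  · conv_rhs => rw [h]
    rw [jacobiSym.neg _ (Nat.odd_iff.mpr (by omega)), ZMod.χ₄_nat_three_mod_four (by omega),
      neg_one_mul, neg_neg, jacobiSym.quadratic_reciprocity_one_mod_four' (by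
        exact Nat.odd_iff.mpr (by omega)) (by omega)]

/-- `χ₂` takes the same value at two tangent circles of coprime curvatures. -/
lemma chiTwoAt_comm {a b : ℤ} (hab : 0 < a + b) (h : a % 12 = 1 ∧ b % 12 = 1 ∨
    a % 12 = 3 ∧ b % 12 = 11 ∨ a % 12 = 11 ∧ b % 12 = 3) :
    chiTwoAt a (a + b) = chiTwoAt b (a + b) := by
  simp only [chiTwoAt, Int.ModEq]
  rw [kroneckerSymbol_eq_jacobiSym hab (by omega), kroneckerSymbol_eq_jacobiSym hab (by omega),
    jacobiSym_add_self, jacobiSym_add_self']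
  rcases h with ⟨h1, h2⟩ | ⟨h1, h2⟩ | ⟨h1, h2⟩
  · simp [h1, h2, jacobiSym_comm_of_one_mod_four (a := a) (b := b) (by omega) (by omega) hab]
  · simp [h1, h2, jacobiSym_comm_of_three_mod_four (a := a) (b := b) (by omega) (by omega) hab]
  · simp [h1, h2, jacobiSym_comm_of_three_mod_four (a := a) (b := b) (by omega) (by omega) hab]

/-- `χ₂ = 1` at a circle whose curvature is a square. -/
lemma chiTwoAt_sq {n ρ : ℤ} (hn : n ^ 2 % 12 = 1) (hρ : 0 < ρ) (hc : IsCoprime ρ (n ^ 2)) :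
    chiTwoAt (n ^ 2) ρ = 1 := by
  have h3 : ¬ n ^ 2 ≡ 3 [ZMOD 12] := by simp only [Int.ModEq]; omega
  rw [chiTwoAt, if_neg h3, kroneckerSymbol_eq_jacobiSym hρ (by omega), Int.natAbs_pow,
    jacobiSym.pow_right, ← jacobiSym.pow_left]
  exact jacobiSym.sq_one' (gcd_natAbs_eq_one (IsCoprime.pow_right_iff (by norm_num) |>.mp hc))

/-- `χ₂ = 1` at a circle of curvature `3 n ^ 2`. -/
lemma chiTwoAt_three_mul_sq {n ρ : ℤ} (hn : 3 * n ^ 2 % 12 = 3) (hρ : 0 < ρ) (hρ3 : ρ % 3 = 2)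
    (hc : IsCoprime ρ (3 * n ^ 2)) : chiTwoAt (3 * n ^ 2) ρ = 1 := by
  have h3 : 3 * n ^ 2 ≡ 3 [ZMOD 12] := hn
  have hn0 : n ≠ 0 := by rintro rfl; norm_num at hn
  have hne : NeZero (n.natAbs ^ 2) := ⟨pow_ne_zero _ (by simpa using hn0)⟩
  have hJ3 : jacobiSym ρ 3 = -1 := by
    rw [jacobiSym.mod_left]
    have : ρ % ((3 : ℕ) : ℤ) = 2 := by push_cast; exact hρ3
    rw [this]
    decide +kernel
  rw [chiTwoAt, if_pos h3, kroneckerSymbol_eq_jacobiSym hρ (by omega), Int.natAbs_mul,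
    Int.natAbs_pow, show Int.natAbs 3 = 3 from rfl, jacobiSym.mul_right, hJ3,
    jacobiSym.pow_right, ← jacobiSym.pow_left, jacobiSym.sq_one' (gcd_natAbs_eq_one
      (IsCoprime.pow_right_iff (by norm_num) |>.mp hc.of_mul_right_right))]
  norm_num

/-! ### Propagation of the quadratic invariant -/

/-- The properties that the curvature form of a primitive packing of type `(1)` or `(3, 11)` has.
They are invariant under symmetries. -/
structure IsRegular (l : NullForm) : Prop where
  primitive : ∀ p : ℕ, p.Prime → ∃ D, Orbit D ∧ ¬ (p : ℤ) ∣ l.eval D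
  nonneg : ∀ C D, Orbit C → Orbit D → inner C D = -1 → 0 ≤ l.eval C + l.eval D
  residues : (∀ D, Orbit D → l.eval D % 12 = 1) ∨
    (∀ D, Orbit D → l.eval D % 12 = 3 ∨ l.eval D % 12 = 11) ∧ ∃ D, Orbit D ∧ 3 ∣ l.eval D

/-- The counterpart of `HasChiTwoAt` for a form on the lattice. -/
def LatticeHasChiTwoAt (l : NullForm) (C : LatticeVector) (ε : ℤ) : Prop :=
  ∃ D, Orbit D ∧ inner C D = -1 ∧ IsCoprime (l.eval C + l.eval D) (l.eval C) ∧
    chiTwoAt (l.eval C) (l.eval C + l.eval D) = ε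

variable {l l' : NullForm} {φ : LatticeVector → LatticeVector} {ε : ℤ}

lemma IsRegular.pull (hl : IsRegular l) (hφ : IsSymmetry φ)
    (h : ∀ D, l'.eval D = l.eval (φ D)) : IsRegular l' where
  primitive p hp := by
    obtain ⟨ψ, h1, h2⟩ := hφ.exists_inv
    obtain ⟨D, hD, hn⟩ := hl.primitive p hp
    exact ⟨ψ D, h1 D hD, by rwa [h, h2]⟩
  nonneg C D hC hD hCD := by
    rw [h, h]
    exact hl.nonneg _ _ (hφ.orbit C hC) (hφ.orbit D hD) (by rwa [hφ.inner_eq])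
  residues := by
    obtain ⟨ψ, h1, h2⟩ := hφ.exists_inv
    rcases hl.residues with hr | ⟨hr, D, hD, h3⟩
    · exact Or.inl fun D hD => by rw [h]; exact hr _ (hφ.orbit D hD)
    · exact Or.inr ⟨fun D hD => by rw [h]; exact hr _ (hφ.orbit D hD),
        ψ D, h1 D hD, by rwa [h, h2]⟩

lemma latticeHasChiTwoAt_pull (hφ : IsSymmetry φ) (h : ∀ D, l'.eval D = l.eval (φ D))
    (C : LatticeVector) : LatticeHasChiTwoAt l' C ε ↔ LatticeHasChiTwoAt l (φ C) ε := by
  constructor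
  · rintro ⟨D, hD, hCD, hc, hε⟩
    simp only [h] at hc hε
    exact ⟨φ D, hφ.orbit D hD, by rwa [hφ.inner_eq], hc, hε⟩
  · rintro ⟨D, hD, hCD, hc, hε⟩
    obtain ⟨ψ, h1, h2⟩ := hφ.exists_inv
    refine ⟨ψ D, h1 D hD, by rwa [← hφ.inner_eq, h2], ?_, ?_⟩ <;> simpa only [h, h2]

namespace IsRegular

lemma emod_twelve (hl : IsRegular l) {D : LatticeVector} (hD : Orbit D) :
    l.eval D % 12 = 1 ∨ l.eval D % 12 = 3 ∨ l.eval D % 12 = 11 := by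
  rcases hl.residues with hr | ⟨hr, -⟩
  · exact Or.inl (hr D hD)
  · exact Or.inr (hr D hD)

lemma add_pos (hl : IsRegular l) {C D : LatticeVector} (hC : Orbit C) (hD : Orbit D)
    (h : inner C D = -1) : 0 < l.eval C + l.eval D := by
  have h0 := hl.nonneg C D hC hD h
  rcases hl.residues with hr | ⟨hr, -⟩
  · have := hr C hC
    have := hr D hD
    omega
  · have := hr C hC
    have := hr D hD
    omega

/-- `χ₂` does not depend on the choice of the tangent circle. -/
lemma chi_unique (hl : IsRegular l) {ε' : ℤ} {C : LatticeVector} (hC : Orbit C)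
    (h : LatticeHasChiTwoAt l C ε) (h' : LatticeHasChiTwoAt l C ε') : ε = ε' := by
  obtain ⟨φ, hφ, rfl⟩ := hC.exists_isSymmetry
  obtain ⟨l', hl'⟩ := hφ.pull l
  rw [← latticeHasChiTwoAt_pull hφ hl'] at h h'
  have hreg := hl.pull hφ hl'
  obtain ⟨D, hD, hi, hc, rfl⟩ := h
  obtain ⟨D', hD', hi', hc', rfl⟩ := h'
  obtain ⟨B, κ, hB⟩ := l'.mul_eq_of_tangent hD hD' hi hi'
  have h0 := Orbit.of_vertex 0 0
  exact chiTwoAt_eq_of_mul_eq (hreg.emod_twelve h0) (hreg.add_pos h0 hD hi)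
    (hreg.add_pos h0 hD' hi') hc hc' hB

/-- No prime divides all three curvatures of a triangle. -/
lemma not_dvd_all (hl : IsRegular l) {p : ℕ} (hp : p.Prime) (ha : (p : ℤ) ∣ l.a)
    (hb : (p : ℤ) ∣ l.b) (hc : (p : ℤ) ∣ l.c) : False := by
  have hp' : Prime (p : ℤ) := Nat.prime_iff_prime_int.mp hp
  have h3t : (p : ℤ) ∣ 3 * l.t := by
    have h : (p : ℤ) ∣ 3 * l.t ^ 2 := by
      rw [l.descartes]
      exact dvd_add (dvd_add (ha.mul_right _) (hb.mul_right _)) (hc.mul_right _)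
    rcases hp'.dvd_or_dvd h with h | h
    · exact h.mul_right _
    · exact (hp'.dvd_of_dvd_pow h).mul_left _
  have hk : (p : ℤ) ∣ l.k := by
    rw [l.k_eq]
    exact dvd_add (dvd_add (dvd_add ha hb) hc) h3t
  have hA : (p : ℤ) ∣ l.A := l.a_eq ▸ ha
  have hU : (p : ℤ) ∣ l.U := by
    have : l.U = l.b - l.A - 2 * l.k := by rw [l.b_eq]; ring
    rw [this]
    exact dvd_sub (dvd_sub hb hA) (hk.mul_left _)
  have hW : (p : ℤ) ∣ l.W := by
    have : l.W = l.c - l.A - 2 * l.k := by rw [l.c_eq]; ring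
    rw [this]
    exact dvd_sub (dvd_sub hc hA) (hk.mul_left _)
  obtain ⟨D, -, hD⟩ := hl.primitive p hp
  exact hD (dvd_add (dvd_add (dvd_add (hA.mul_right _) ((hk.mul_left _).mul_right _))
    (hU.mul_right _)) (hW.mul_right _))

/-- In type `(3, 11)`, two of the three curvatures of a triangle are divisible by `3`. -/
lemma mod_three (hl : IsRegular l) : (l.a % 12 = 1 ∧ l.b % 12 = 1 ∧ l.c % 12 = 1) ∨
    (l.a % 12 = 3 ∧ l.b % 12 = 3 ∧ l.c % 12 = 11) ∨
    (l.a % 12 = 3 ∧ l.b % 12 = 11 ∧ l.c % 12 = 3) ∨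
    (l.a % 12 = 11 ∧ l.b % 12 = 3 ∧ l.c % 12 = 3) := by
  rcases hl.residues with hr | ⟨hr, D, hD, h3⟩
  · exact Or.inl ⟨hr _ (.of_vertex _ _), hr _ (.of_vertex _ _), hr _ (.of_vertex _ _)⟩
  right
  have ha : l.a % 12 = 3 ∨ l.a % 12 = 11 := hr _ (.of_vertex _ _)
  have hb : l.b % 12 = 3 ∨ l.b % 12 = 11 := hr _ (.of_vertex _ _)
  have hc : l.c % 12 = 3 ∨ l.c % 12 = 11 := hr _ (.of_vertex _ _)
  have hm := l.eval_modEq_three hD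
  have hd : (l.a * l.b + l.b * l.c + l.c * l.a) % 3 = 0 := by rw [← l.descartes]; omega
  have e : (l.a * l.b + l.b * l.c + l.c * l.a) % 3
      = ((l.a % 3) * (l.b % 3) + (l.b % 3) * (l.c % 3) + (l.c % 3) * (l.a % 3)) % 3 := by
    simp [Int.add_emod, Int.mul_emod]
  rw [e] at hd
  have hn := fun h1 h2 h3 => hl.not_dvd_all Nat.prime_three (Int.dvd_of_emod_eq_zero h1)
    (Int.dvd_of_emod_eq_zero h2) (Int.dvd_of_emod_eq_zero h3)
  push_cast at hn
  have k (x y z : ℤ) (hx : l.a % 3 = x) (hy : l.b % 3 = y) (hz : l.c % 3 = z) :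
      (x * y + y * z + z * x) % 3 = 0 := by rw [← hx, ← hy, ← hz]; exact hd
  clear e hd
  have k5 : ¬ (l.a % 12 = 11 ∧ l.b % 12 = 11 ∧ l.c % 12 = 11) := by
    rintro ⟨h1, h2, h4⟩; clear ha hb hc hn k; omega
  rcases ha with h1 | h1 <;> rcases hb with h2 | h2 <;> rcases hc with h4 | h4
  · exact (hn (by omega) (by omega) (by omega)).elim
  · exact Or.inl ⟨h1, h2, h4⟩
  · exact Or.inr (Or.inl ⟨h1, h2, h4⟩)
  · exact absurd (k 0 2 2 (by omega) (by omega) (by omega)) (by decide)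
  · exact Or.inr (Or.inr ⟨h1, h2, h4⟩)
  · exact absurd (k 2 0 2 (by omega) (by omega) (by omega)) (by decide)
  · exact absurd (k 2 2 0 (by omega) (by omega) (by omega)) (by decide)
  · exact (k5 ⟨h1, h2, h4⟩).elim

lemma chi_of_isCoprime (hl : IsRegular l) (h : IsCoprime l.a l.b)
    (hε : LatticeHasChiTwoAt l (vertex 0 0) ε) : LatticeHasChiTwoAt l (vertex 1 0) ε := by
  have h0 := Orbit.of_vertex 0 0
  have h1 := Orbit.of_vertex 1 0
  have hi : inner (vertex 0 0) (vertex 1 0) = -1 := by decide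
  have hi' : inner (vertex 1 0) (vertex 0 0) = -1 := by decide
  have hpos := hl.add_pos h0 h1 hi
  have hval : chiTwoAt l.a (l.a + l.b) = ε := by
    refine hl.chi_unique h0 ⟨vertex 1 0, h1, hi, ?_, rfl⟩ hε
    have h2 := h.symm.add_mul_left_left 1
    rwa [mul_one, add_comm] at h2
  have hcase := hl.mod_three
  have hn3 : ¬ (l.a % 12 = 3 ∧ l.b % 12 = 3) := fun hh => by
    have := h.isUnit_of_dvd' (x := 3) (by omega) (by omega)
    exact absurd this (by decide)
  refine ⟨vertex 0 0, h0, hi', ?_, ?_⟩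
  · have h2 := h.add_mul_left_left 1
    rw [mul_one, add_comm] at h2
    exact h2
  · rw [add_comm, ← hval]
    exact (chiTwoAt_comm hpos (by
      change l.a % 12 = 1 ∧ l.b % 12 = 1 ∨ l.a % 12 = 3 ∧ l.b % 12 = 11 ∨
        l.a % 12 = 11 ∧ l.b % 12 = 3
      omega)).symm

lemma chi_ab_iff_of_isCoprime (hl : IsRegular l) (h : IsCoprime l.a l.b) :
    LatticeHasChiTwoAt l (vertex 0 0) ε ↔ LatticeHasChiTwoAt l (vertex 1 0) ε := by
  refine ⟨hl.chi_of_isCoprime h, fun hε => ?_⟩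
  obtain ⟨l', hl'⟩ := isSymmetry_swapAB.pull l
  obtain ⟨ha, hb, -⟩ := NullForm.pull_swapAB hl'
  have h1 := (hl.pull isSymmetry_swapAB hl').chi_of_isCoprime (ε := ε) (by
    rw [ha, hb]; exact h.symm)
  rw [latticeHasChiTwoAt_pull isSymmetry_swapAB hl',
    latticeHasChiTwoAt_pull isSymmetry_swapAB hl'] at h1
  exact h1 hε

lemma chi_ac_iff_of_isCoprime (hl : IsRegular l) (h : IsCoprime l.a l.c) :
    LatticeHasChiTwoAt l (vertex 0 0) ε ↔ LatticeHasChiTwoAt l (vertex 0 1) ε := by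
  obtain ⟨l', hl'⟩ := isSymmetry_swapBC.pull l
  obtain ⟨ha, hb, -⟩ := NullForm.pull_swapBC hl'
  have h1 := (hl.pull isSymmetry_swapBC hl').chi_ab_iff_of_isCoprime (ε := ε) (by
    rwa [ha, hb])
  rwa [latticeHasChiTwoAt_pull isSymmetry_swapBC hl',
    latticeHasChiTwoAt_pull isSymmetry_swapBC hl'] at h1

lemma chi_bc_iff_of_isCoprime (hl : IsRegular l) (h : IsCoprime l.b l.c) :
    LatticeHasChiTwoAt l (vertex 1 0) ε ↔ LatticeHasChiTwoAt l (vertex 0 1) ε := by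
  obtain ⟨l', hl'⟩ := isSymmetry_swapAB.pull l
  obtain ⟨ha, -, hc, -⟩ := NullForm.pull_swapAB hl'
  have h1 := (hl.pull isSymmetry_swapAB hl').chi_ac_iff_of_isCoprime (ε := ε) (by
    rwa [ha, hc])
  rwa [latticeHasChiTwoAt_pull isSymmetry_swapAB hl',
    latticeHasChiTwoAt_pull isSymmetry_swapAB hl'] at h1

end IsRegular

/-- A polynomial-like function on `ℤ` that is not identically zero modulo any prime divisor of `M`
takes a value coprime to `M`. -/
lemma exists_isCoprime_value (f : ℤ → ℤ) (hf : ∀ i j, i - j ∣ f i - f j) (M : ℕ) (hM : M ≠ 0)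
    (h : ∀ p : ℕ, p.Prime → p ∣ M → ∃ j, ¬ (p : ℤ) ∣ f j) : ∃ j, IsCoprime (f j) M := by
  induction M using Nat.recOnPosPrimePosCoprime with
  | zero => exact absurd rfl hM
  | one => exact ⟨0, by simpa using isCoprime_one_right⟩
  | prime_pow p n hp hn =>
    obtain ⟨j, hj⟩ := h p hp (dvd_pow_self p hn.ne')
    refine ⟨j, ?_⟩
    push_cast
    exact (((Nat.prime_iff_prime_int.mp hp).coprime_iff_not_dvd).mpr hj).symm.pow_right
  | coprime x y hx hy hxy ihx ihy =>
    obtain ⟨i, hi⟩ := ihx (by omega) fun p hp hd => h p hp (hd.mul_right y)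
    obtain ⟨j, hj⟩ := ihy (by omega) fun p hp hd => h p hp (hd.mul_left x)
    obtain ⟨u, v, huv⟩ : IsCoprime (x : ℤ) y := Nat.isCoprime_iff_coprime.mpr hxy
    -- an integer congruent to `i` modulo `x` and to `j` modulo `y`
    have h1 : (x : ℤ) ∣ (i * (v * y) + j * (u * x)) - i := ⟨u * (j - i), by
      linear_combination i * huv⟩
    have h2 : (y : ℤ) ∣ (i * (v * y) + j * (u * x)) - j := ⟨v * (i - j), by
      linear_combination j * huv⟩
    refine ⟨i * (v * y) + j * (u * x), ?_⟩
    obtain ⟨q, hq⟩ := h1.trans (hf _ _)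
    obtain ⟨r, hr⟩ := h2.trans (hf _ _)
    push_cast
    refine IsCoprime.mul_right ?_ ?_
    · rw [sub_eq_iff_eq_add.mp hq, add_comm]
      exact hi.add_mul_left_left q
    · rw [sub_eq_iff_eq_add.mp hr, add_comm]
      exact hj.add_mul_left_left r

namespace IsRegular

/-- A prime `p` dividing `a b` does not divide all curvatures of the chain of circles tangent to
those of curvatures `a` and `b`, except that `p = 3` may if it divides just one of `a` and `b`. -/
lemma exists_not_dvd_chain (hl : IsRegular l) {p : ℕ} (hp : p.Prime)
    (hab : (p : ℤ) ∣ l.a ∨ (p : ℤ) ∣ l.b) (h3 : p = 3 → (p : ℤ) ∣ l.a ∧ (p : ℤ) ∣ l.b) :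
    ∃ j, ¬ (p : ℤ) ∣ l.c + 6 * l.t * j + 3 * (l.a + l.b) * j ^ 2 := by
  by_contra! hall
  have h0 : (p : ℤ) ∣ l.c := by simpa using hall 0
  have h1 := hall 1
  have hp' : Prime (p : ℤ) := Nat.prime_iff_prime_int.mp hp
  by_cases hp3 : p = 3
  · exact hl.not_dvd_all hp (h3 hp3).1 (h3 hp3).2 h0
  have hp3' : ¬ (p : ℤ) ∣ 3 := fun hd => hp3 ((Nat.prime_dvd_prime_iff_eq hp Nat.prime_three).mp
    (by exact_mod_cast hd))
  have ht : (p : ℤ) ∣ l.t := by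
    have h : (p : ℤ) ∣ 3 * l.t ^ 2 := by
      rw [l.descartes]
      refine dvd_add (dvd_add ?_ (h0.mul_left _)) (h0.mul_right _)
      rcases hab with h | h
      · exact h.mul_right _
      · exact h.mul_left _
    exact hp'.dvd_of_dvd_pow ((hp'.dvd_or_dvd h).resolve_left hp3')
  have hsum : (p : ℤ) ∣ l.a + l.b := by
    have h : (p : ℤ) ∣ 3 * (l.a + l.b) := by
      have e : 3 * (l.a + l.b) = (l.c + 6 * l.t * 1 + 3 * (l.a + l.b) * 1 ^ 2) - l.c - l.t * 6 := by
        ring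
      rw [e]
      exact dvd_sub (dvd_sub h1 h0) (ht.mul_right _)
    exact (hp'.dvd_or_dvd h).resolve_left hp3'
  rcases hab with h | h
  · exact hl.not_dvd_all hp h ((dvd_add_right h).mp hsum) h0
  · exact hl.not_dvd_all hp ((dvd_add_left h).mp hsum) h h0

lemma exists_isCoprime_chain (hl : IsRegular l) (M : ℤ) (hM : M ≠ 0)
    (h : ∀ p : ℕ, p.Prime → (p : ℤ) ∣ M → ((p : ℤ) ∣ l.a ∨ (p : ℤ) ∣ l.b) ∧
      (p = 3 → (p : ℤ) ∣ l.a ∧ (p : ℤ) ∣ l.b)) :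
    ∃ j, IsCoprime (l.c + 6 * l.t * j + 3 * (l.a + l.b) * j ^ 2) M := by
  obtain ⟨j, hj⟩ := exists_isCoprime_value
    (fun j => l.c + 6 * l.t * j + 3 * (l.a + l.b) * j ^ 2)
    (fun i j => ⟨6 * l.t + 3 * (l.a + l.b) * (i + j), by ring⟩) M.natAbs (by simpa using hM)
    (fun p hp hd => by
      have hd' : (p : ℤ) ∣ M := Int.natCast_dvd.mpr hd
      exact hl.exists_not_dvd_chain hp (h p hp hd').1 (h p hp hd').2)
  refine ⟨j, ?_⟩
  rw [Int.isCoprime_iff_gcd_eq_one] at hj ⊢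
  simpa only [Int.gcd, Int.natAbs_natCast] using hj

lemma a_ne_zero (hl : IsRegular l) : l.a ≠ 0 := by
  have := hl.mod_three
  omega

lemma b_ne_zero (hl : IsRegular l) : l.b ≠ 0 := by
  have := hl.mod_three
  omega

/-- If `3` divides both or none of `a` and `b`, some circle tangent to those of curvatures `a` and
`b` has curvature coprime to both. -/
lemma chi_ab_iff_of_dvd_iff (hl : IsRegular l) (h3 : 3 ∣ l.a ↔ 3 ∣ l.b) :
    LatticeHasChiTwoAt l (vertex 0 0) ε ↔ LatticeHasChiTwoAt l (vertex 1 0) ε := by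
  obtain ⟨j, hj⟩ := hl.exists_isCoprime_chain (l.a * l.b)
    (mul_ne_zero hl.a_ne_zero hl.b_ne_zero) (fun p hp hd => by
      have hor := (Nat.prime_iff_prime_int.mp hp).dvd_or_dvd hd
      refine ⟨hor, ?_⟩
      rintro rfl
      push_cast at hor ⊢
      tauto)
  obtain ⟨φ, hφ, h0, h1, l', hl', ha, hb, hc, -⟩ := l.exists_chain j
  have hreg := hl.pull hφ hl'
  rw [← hc, ← ha, ← hb] at hj
  have e1 := hreg.chi_ac_iff_of_isCoprime (ε := ε) hj.of_mul_right_left.symm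
  have e2 := hreg.chi_bc_iff_of_isCoprime (ε := ε) hj.of_mul_right_right.symm
  rw [← e2, latticeHasChiTwoAt_pull hφ hl', latticeHasChiTwoAt_pull hφ hl', h0, h1] at e1
  exact e1

lemma chi_ab_iff_of_three_dvd (hl : IsRegular l) (h3a : 3 ∣ l.a) (h3b : ¬ 3 ∣ l.b) :
    LatticeHasChiTwoAt l (vertex 0 0) ε ↔ LatticeHasChiTwoAt l (vertex 1 0) ε := by
  -- A circle tangent to both with curvature coprime to `b` is divisible by `3`; it is compared
  -- with `a` by the previous lemma.
  obtain ⟨j, hj⟩ := hl.exists_isCoprime_chain l.b hl.b_ne_zero (fun p hp hd => by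
      refine ⟨Or.inr hd, ?_⟩
      rintro rfl
      exact absurd hd h3b)
  obtain ⟨φ, hφ, h0, h1, l', hl', ha, hb, hc, -⟩ := l.exists_chain j
  have hreg := hl.pull hφ hl'
  rw [← hc, ← hb] at hj
  have e2 := hreg.chi_bc_iff_of_isCoprime (ε := ε) hj.symm
  have hmod := hreg.mod_three
  obtain ⟨l₂, hl₂⟩ := isSymmetry_swapBC.pull l'
  obtain ⟨ha₂, hb₂, -⟩ := NullForm.pull_swapBC hl₂
  have e1 := (hreg.pull isSymmetry_swapBC hl₂).chi_ab_iff_of_dvd_iff (ε := ε) (by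
    rw [ha₂, hb₂]; omega)
  rw [latticeHasChiTwoAt_pull isSymmetry_swapBC hl₂,
    latticeHasChiTwoAt_pull isSymmetry_swapBC hl₂] at e1
  change LatticeHasChiTwoAt l' (vertex 0 0) ε ↔ LatticeHasChiTwoAt l' (vertex 0 1) ε at e1
  rw [← e2, latticeHasChiTwoAt_pull hφ hl', latticeHasChiTwoAt_pull hφ hl', h0, h1] at e1
  exact e1

lemma chi_ab_iff (hl : IsRegular l) :
    LatticeHasChiTwoAt l (vertex 0 0) ε ↔ LatticeHasChiTwoAt l (vertex 1 0) ε := by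
  by_cases h3a : 3 ∣ l.a <;> by_cases h3b : 3 ∣ l.b
  · exact hl.chi_ab_iff_of_dvd_iff (by tauto)
  · exact hl.chi_ab_iff_of_three_dvd h3a h3b
  · obtain ⟨l', hl'⟩ := isSymmetry_swapAB.pull l
    obtain ⟨ha, hb, -⟩ := NullForm.pull_swapAB hl'
    have e := (hl.pull isSymmetry_swapAB hl').chi_ab_iff_of_three_dvd (ε := ε) (by rwa [ha])
      (by rwa [hb])
    rw [latticeHasChiTwoAt_pull isSymmetry_swapAB hl',
      latticeHasChiTwoAt_pull isSymmetry_swapAB hl'] at e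
    exact e.symm
  · exact hl.chi_ab_iff_of_dvd_iff (by tauto)

lemma chi_ac_iff (hl : IsRegular l) :
    LatticeHasChiTwoAt l (vertex 0 0) ε ↔ LatticeHasChiTwoAt l (vertex 0 1) ε := by
  obtain ⟨l', hl'⟩ := isSymmetry_swapBC.pull l
  have e := (hl.pull isSymmetry_swapBC hl').chi_ab_iff (ε := ε)
  rwa [latticeHasChiTwoAt_pull isSymmetry_swapBC hl',
    latticeHasChiTwoAt_pull isSymmetry_swapBC hl'] at e

lemma chi_vertex_iff (hl : IsRegular l) (m n : ℤ) :
    LatticeHasChiTwoAt l (vertex m n) ε ↔ LatticeHasChiTwoAt l (vertex 0 0) ε := by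
  have htr : ∀ m n x y, translate m n (vertex x y) = vertex (m + x) (n + y) := fun m n x y => by
    ext <;> simp only [translate, vertex, eisensteinNorm] <;> ring
  have step1 : ∀ m n : ℤ,
      LatticeHasChiTwoAt l (vertex m n) ε ↔ LatticeHasChiTwoAt l (vertex (m + 1) n) ε := by
    intro m n
    obtain ⟨l', hl'⟩ := (isSymmetry_translate m n).pull l
    have e := (hl.pull (isSymmetry_translate m n) hl').chi_ab_iff (ε := ε)
    rw [latticeHasChiTwoAt_pull (isSymmetry_translate m n) hl',
      latticeHasChiTwoAt_pull (isSymmetry_translate m n) hl', htr, htr] at e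
    simpa using e
  have step2 : ∀ m n : ℤ,
      LatticeHasChiTwoAt l (vertex m n) ε ↔ LatticeHasChiTwoAt l (vertex m (n + 1)) ε := by
    intro m n
    obtain ⟨l', hl'⟩ := (isSymmetry_translate m n).pull l
    have e := (hl.pull (isSymmetry_translate m n) hl').chi_ac_iff (ε := ε)
    rw [latticeHasChiTwoAt_pull (isSymmetry_translate m n) hl',
      latticeHasChiTwoAt_pull (isSymmetry_translate m n) hl', htr, htr] at e
    simpa using e
  have hm : ∀ m n : ℤ,
      LatticeHasChiTwoAt l (vertex m n) ε ↔ LatticeHasChiTwoAt l (vertex 0 n) ε := by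
    intro m n
    induction m with
    | zero => rfl
    | succ m ih => rw [← step1, ih]
    | pred m ih => rw [← ih, step1, sub_add_cancel]
  rw [hm]
  induction n with
  | zero => rfl
  | succ n ih => exact (step2 0 n).symm.trans ih
  | pred n ih =>
    have e := step2 0 (-(n : ℤ) - 1)
    rw [sub_add_cancel] at e
    exact e.trans ih

/-- `χ₂` is constant on the packing. -/
lemma chi_iff {C : LatticeVector} (hC : Orbit C) (hl : IsRegular l) :
    LatticeHasChiTwoAt l C ε ↔ LatticeHasChiTwoAt l (vertex 0 0) ε := by
  induction hC generalizing l with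
  | of_vertex m n => exact hl.chi_vertex_iff m n
  | @of_reflect Δ C _ ih =>
    -- the reflection fixes the vertices of `Δ`, one of which is `vertex Δ.x Δ.y`
    have hfix : Δ.reflect (vertex Δ.x Δ.y) = vertex Δ.x Δ.y := by
      apply Triangle.reflect_eq_self
      simp only [Triangle.pair, vertex, Triangle.height, eisensteinNorm]
      ring
    obtain ⟨l', hl'⟩ := Δ.isSymmetry_reflect.pull l
    have hreg := hl.pull Δ.isSymmetry_reflect hl'
    rw [← latticeHasChiTwoAt_pull Δ.isSymmetry_reflect hl', ih hreg,
      ← hreg.chi_vertex_iff Δ.x Δ.y, latticeHasChiTwoAt_pull Δ.isSymmetry_reflect hl', hfix,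
      hl.chi_vertex_iff]

lemma sq_ne_eval (hl : IsRegular l) (h1 : ∀ D, Orbit D → l.eval D % 12 = 1)
    (hchi : ∃ C, Orbit C ∧ LatticeHasChiTwoAt l C (-1)) {D : LatticeVector} (hD : Orbit D)
    (n : ℤ) : l.eval D ≠ n ^ 2 := by
  intro hn
  obtain ⟨C, hC, hε⟩ := hchi
  rw [chi_iff hC hl, ← chi_iff hD hl] at hε
  obtain ⟨E, hE, hi, hc, hε⟩ := hε
  have hpos := hl.add_pos hD hE hi
  have hm := h1 D hD
  generalize l.eval D + l.eval E = ρ at hε hc hpos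
  rw [hn] at hc hε hm
  rw [chiTwoAt_sq hm hpos hc] at hε
  norm_num at hε

lemma three_mul_sq_ne_eval (hl : IsRegular l)
    (h1 : ∀ D, Orbit D → l.eval D % 12 = 3 ∨ l.eval D % 12 = 11)
    (hchi : ∃ C, Orbit C ∧ LatticeHasChiTwoAt l C (-1)) {D : LatticeVector} (hD : Orbit D)
    (n : ℤ) : l.eval D ≠ 3 * n ^ 2 := by
  intro hn
  obtain ⟨C, hC, hε⟩ := hchi
  rw [chi_iff hC hl, ← chi_iff hD hl] at hε
  obtain ⟨E, hE, hi, hc, hε⟩ := hε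
  have hpos := hl.add_pos hD hE hi
  have hm := h1 D hD
  have hmE := h1 E hE
  have h3 : (l.eval D + l.eval E) % 3 = 2 := by
    have hnd : ¬ (3 : ℤ) ∣ l.eval D + l.eval E := fun hd => by
      have := hc.isUnit_of_dvd' hd (by omega)
      exact absurd this (by decide)
    omega
  generalize l.eval D + l.eval E = ρ at hε hc hpos h3
  rw [hn] at hc hε hm
  rw [chiTwoAt_three_mul_sq (by omega) hpos h3 hc] at hε
  norm_num at hε

end IsRegular

/-! ### Moves on triangles and the Chinese remainder theorem -/

/-- The curvatures `a`, `b`, `c` of a triangle together with `t`. -/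
@[ext]
structure Quad where
  a : ℤ
  b : ℤ
  c : ℤ
  t : ℤ

/-- The three vertices of a triangle. -/
inductive Corner
  | A
  | B
  | C

namespace Quad

/-- Replaces one circle of a triangle by the `j`-th next circle of the chain of circles tangent to
the other two. -/
def move (s : Quad) : Corner → ℤ → Quad
  | .A, j => ⟨s.a + 6 * s.t * j + 3 * (s.b + s.c) * j ^ 2, s.b, s.c, s.t + (s.b + s.c) * j⟩
  | .B, j => ⟨s.a, s.b + 6 * s.t * j + 3 * (s.a + s.c) * j ^ 2, s.c, s.t + (s.a + s.c) * j⟩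
  | .C, j => ⟨s.a, s.b, s.c + 6 * s.t * j + 3 * (s.a + s.b) * j ^ 2, s.t + (s.a + s.b) * j⟩

/-- Componentwise congruence. -/
def Congr (q : ℤ) (s s' : Quad) : Prop :=
  s.a ≡ s'.a [ZMOD q] ∧ s.b ≡ s'.b [ZMOD q] ∧ s.c ≡ s'.c [ZMOD q] ∧ s.t ≡ s'.t [ZMOD q]

lemma Congr.refl (q : ℤ) (s : Quad) : Congr q s s := ⟨rfl, rfl, rfl, rfl⟩

lemma Congr.trans {q : ℤ} {s s' s'' : Quad} (h : Congr q s s') (h' : Congr q s' s'') :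
    Congr q s s'' :=
  ⟨h.1.trans h'.1, h.2.1.trans h'.2.1, h.2.2.1.trans h'.2.2.1, h.2.2.2.trans h'.2.2.2⟩

lemma Congr.move {q : ℤ} {s s' : Quad} (h : Congr q s s') {j j' : ℤ} (hj : j ≡ j' [ZMOD q])
    (i : Corner) : Congr q (s.move i j) (s'.move i j') := by
  obtain ⟨ha, hb, hc, ht⟩ := h
  cases i
  · exact ⟨(ha.add ((ht.mul_left 6).mul hj)).add (((hb.add hc).mul_left 3).mul (hj.pow 2)), hb, hc,
      ht.add ((hb.add hc).mul hj)⟩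
  · exact ⟨ha, (hb.add ((ht.mul_left 6).mul hj)).add (((ha.add hc).mul_left 3).mul (hj.pow 2)), hc,
      ht.add ((ha.add hc).mul hj)⟩
  · exact ⟨ha, hb, (hc.add ((ht.mul_left 6).mul hj)).add (((ha.add hb).mul_left 3).mul (hj.pow 2)),
      ht.add ((ha.add hb).mul hj)⟩

lemma move_zero (s : Quad) (i : Corner) : s.move i 0 = s := by
  cases i <;> ext <;> simp [move]

/-- The quadruples reached from `s` by moves. -/
inductive Reach (s : Quad) : Quad → Prop
  | refl : Reach s s
  | move {s' : Quad} (i : Corner) (j : ℤ) : Reach s s' → Reach s (s'.move i j)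

lemma Reach.trans {s s' s'' : Quad} (h : Reach s s') (h' : Reach s' s'') : Reach s s'' := by
  induction h' with
  | refl => exact h
  | move i j _ ih => exact ih.move i j

/-- The relation satisfied by the triangles of a packing. -/
def Valid (s : Quad) : Prop := 3 * s.t ^ 2 = s.a * s.b + s.b * s.c + s.c * s.a

lemma Valid.move {s : Quad} (h : s.Valid) (i : Corner) (j : ℤ) : (s.move i j).Valid := by
  cases i <;> simp only [Valid, Quad.move] at h ⊢ <;> linear_combination h

lemma Valid.of_reach {s s' : Quad} (h : s.Valid) (h' : Reach s s') : s'.Valid := by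
  induction h' with
  | refl => exact h
  | move i j _ ih => exact ih.move i j

/-- A sequence of moves can be replayed modulo `q` without changing anything modulo a coprime
number `q'`, by taking the parameters divisible by `q'`. -/
lemma Reach.replay {q q' : ℤ} (hq : IsCoprime q q') {s s₁ : Quad} (h : Reach s s₁) {s' : Quad}
    (hs : Congr q s' s) : ∃ s'', Reach s' s'' ∧ Congr q s'' s₁ ∧ Congr q' s'' s' := by
  induction h with
  | refl => exact ⟨s', .refl, hs, .refl _ _⟩
  | @move s₂ i j _ ih =>
    obtain ⟨s'', h1, h2, h3⟩ := ih
    obtain ⟨u, v, huv⟩ := hq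
    have hj : j * (v * q') ≡ j [ZMOD q] :=
      (Int.modEq_iff_dvd.mpr ⟨j * u, by linear_combination -j * huv⟩)
    have hj' : j * (v * q') ≡ 0 [ZMOD q'] :=
      (Int.modEq_iff_dvd.mpr ⟨-(j * v), by ring⟩)
    refine ⟨s''.move i (j * (v * q')), h1.move _ _, h2.move hj i, ?_⟩
    have h4 := (Congr.refl q' s'').move hj' i
    rw [move_zero] at h4
    exact h4.trans h3

lemma Reach.chineseRemainder {q q' : ℤ} (hq : IsCoprime q q') {s s₁ s₂ : Quad} (h₁ : Reach s s₁)
    (h₂ : Reach s s₂) : ∃ s', Reach s s' ∧ Congr q s' s₁ ∧ Congr q' s' s₂ := by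
  obtain ⟨r, hr, hr1, hr2⟩ := h₁.replay hq (Congr.refl q s)
  obtain ⟨r', hr', hr1', hr2'⟩ := h₂.replay hq.symm hr2
  exact ⟨r', hr.trans hr', hr2'.trans hr1, hr1'⟩

/-- A value is attained by `c` modulo every number if it is attained modulo prime powers. -/
lemma exists_reach_modEq (s : Quad) (N : ℤ)
    (h : ∀ p : ℕ, p.Prime → ∀ k, ∃ s', Reach s s' ∧ s'.c ≡ N [ZMOD (p ^ k : ℕ)])
    (M : ℕ) (hM : M ≠ 0) : ∃ s', Reach s s' ∧ s'.c ≡ N [ZMOD M] := by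
  induction M using Nat.recOnPosPrimePosCoprime with
  | zero => exact absurd rfl hM
  | one => exact ⟨s, .refl, by simpa using Int.modEq_one⟩
  | prime_pow p n hp hn => exact h p hp n
  | coprime x y hx hy hxy ihx ihy =>
    obtain ⟨s₁, h₁, e₁⟩ := ihx (by omega)
    obtain ⟨s₂, h₂, e₂⟩ := ihy (by omega)
    have hc : IsCoprime (x : ℤ) y := Nat.isCoprime_iff_coprime.mpr hxy
    obtain ⟨s', hs', h3, h4⟩ := h₁.chineseRemainder hc h₂
    refine ⟨s', hs', ?_⟩
    push_cast
    exact (Int.modEq_and_modEq_iff_modEq_mul (by simpa using hxy)).mp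
      ⟨h3.2.2.1.trans e₁, h4.2.2.1.trans e₂⟩

end Quad

/-! ### Local solutions -/

/-- A function on `ℤ` whose difference quotients are units modulo `q` is surjective modulo `q`. -/
lemma exists_modEq_of_isCoprime_quotient {q : ℕ} (hq : q ≠ 0) (f : ℤ → ℤ) (u : ℤ → ℤ → ℤ)
    (hf : ∀ i j, f i - f j = (i - j) * u i j) (hu : ∀ i j, IsCoprime (u i j) q) (y : ℤ) :
    ∃ i, f i ≡ y [ZMOD q] := by
  have : NeZero q := ⟨hq⟩
  have hinj : Function.Injective fun x : ZMod q => (f (x.val : ℤ) : ZMod q) := by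
    intro x y hxy
    have h1 : (q : ℤ) ∣ f (y.val : ℤ) - f (x.val : ℤ) :=
      (ZMod.intCast_eq_intCast_iff_dvd_sub _ _ _).mp hxy
    rw [hf] at h1
    have h2 := (hu _ _).symm.dvd_of_dvd_mul_right h1
    have h3 := (ZMod.intCast_eq_intCast_iff_dvd_sub _ _ _).mpr h2
    simpa using h3
  obtain ⟨x, hx⟩ := (Finite.injective_iff_surjective.mp hinj) (y : ZMod q)
  exact ⟨x.val, (ZMod.intCast_eq_intCast_iff _ _ _).mp hx⟩

lemma isCoprime_prime_pow {p : ℕ} (hp : p.Prime) {x : ℤ} (hx : ¬ (p : ℤ) ∣ x) (k : ℕ) :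
    IsCoprime x ((p ^ k : ℕ) : ℤ) := by
  push_cast
  exact (((Nat.prime_iff_prime_int.mp hp).coprime_iff_not_dvd).mpr hx).symm.pow_right

/-- Squares that are units modulo an odd prime lift to squares modulo its powers. -/
lemma exists_sq_modEq_prime_pow {p : ℕ} (hp : p.Prime) (hp2 : p ≠ 2) {x r : ℤ}
    (hx : ¬ (p : ℤ) ∣ x) (h : x ^ 2 ≡ r [ZMOD p]) (k : ℕ) :
    ∃ y, ¬ (p : ℤ) ∣ y ∧ y ^ 2 ≡ r [ZMOD (p ^ (k + 1) : ℕ)] := by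
  have hp' : Prime (p : ℤ) := Nat.prime_iff_prime_int.mp hp
  induction k with
  | zero => exact ⟨x, hx, by simpa using h⟩
  | succ k ih =>
    obtain ⟨y, hy, hr⟩ := ih
    obtain ⟨w, hw⟩ := Int.modEq_iff_dvd.mp hr
    have h2 : ¬ (p : ℤ) ∣ 2 * y := fun hd => by
      rcases hp'.dvd_or_dvd hd with h | h
      · exact hp2 ((Nat.prime_dvd_prime_iff_eq hp Nat.prime_two).mp (by exact_mod_cast h))
      · exact hy h
    obtain ⟨u, v, huv⟩ := (hp'.coprime_iff_not_dvd).mpr h2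
    push_cast at hw ⊢
    refine ⟨y + p ^ (k + 1) * (v * w), fun hd => hy ?_, ?_⟩
    · have h3 : (p : ℤ) ∣ p ^ (k + 1) * (v * w) :=
        (dvd_pow_self _ (Nat.succ_ne_zero k)).mul_right _
      exact (dvd_add_left h3).mp hd
    · refine Int.modEq_iff_dvd.mpr ⟨u * w - p ^ k * (v * w) ^ 2, ?_⟩
      linear_combination hw - p ^ (k + 1) * w * huv

/-- A polynomial of degree at most `2` that is not constant modulo `p ≥ 5` avoids any two values. -/
lemma exists_avoid {p : ℕ} (hp : p.Prime) (hp5 : 5 ≤ p) (α β γ v w : ℤ)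
    (h : ¬ ((p : ℤ) ∣ β ∧ (p : ℤ) ∣ γ)) :
    ∃ j, ¬ (p : ℤ) ∣ α + β * j + γ * j ^ 2 - v ∧ ¬ (p : ℤ) ∣ α + β * j + γ * j ^ 2 - w := by
  have : Fact p.Prime := ⟨hp⟩
  by_contra! hall
  open Polynomial in
  let f : ℤ → (ZMod p)[X] := fun v => C (γ : ZMod p) * X ^ 2 + C (β : ZMod p) * X
    + C ((α - v : ℤ) : ZMod p)
  have hdeg : ∀ v, (f v).natDegree ≤ 2 := fun v => Polynomial.natDegree_quadratic_le
  have hne : ∀ v, f v ≠ 0 := by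
    intro v h0
    apply h
    have h1 : (β : ZMod p) = 0 := by
      have h := congrArg (fun g => Polynomial.coeff g 1) h0
      simpa only [f, Polynomial.coeff_add, Polynomial.coeff_C_mul, Polynomial.coeff_X_pow,
        Polynomial.coeff_X_one, Polynomial.coeff_C_succ, Polynomial.coeff_zero, OfNat.one_ne_ofNat,
        if_false, mul_zero, mul_one, zero_add, add_zero] using h
    have h2 : (γ : ZMod p) = 0 := by
      have h := congrArg (fun g => Polynomial.coeff g 2) h0
      simpa only [f, Polynomial.coeff_add, Polynomial.coeff_C_mul, Polynomial.coeff_X_pow,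
        Polynomial.coeff_X, Polynomial.coeff_C_succ, Polynomial.coeff_zero, OfNat.one_ne_ofNat,
        if_false, if_true, mul_zero, mul_one, zero_add, add_zero] using h
    exact ⟨(ZMod.intCast_zmod_eq_zero_iff_dvd _ _).mp h1,
      (ZMod.intCast_zmod_eq_zero_iff_dvd _ _).mp h2⟩
  have heval : ∀ v (j : ℤ),
      (f v).eval (j : ZMod p) = ((α + β * j + γ * j ^ 2 - v : ℤ) : ZMod p) := by
    intro v j
    simp [f]
    ring
  refine mul_ne_zero (hne v) (hne w) ?_
  refine Polynomial.eq_zero_of_natDegree_lt_card_of_eval_eq_zero _ (f := (id : ZMod p → ZMod p))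
    Function.injective_id (fun x => ?_) ?_
  · obtain ⟨j, rfl⟩ := ZMod.intCast_surjective x
    rw [Polynomial.eval_mul, mul_eq_zero, id, heval, heval]
    by_cases hv : (p : ℤ) ∣ α + β * j + γ * j ^ 2 - v
    · exact Or.inl ((ZMod.intCast_zmod_eq_zero_iff_dvd _ _).mpr hv)
    · exact Or.inr ((ZMod.intCast_zmod_eq_zero_iff_dvd _ _).mpr (hall j hv))
  · rw [ZMod.card]
    have := Polynomial.natDegree_mul_le (p := f v) (q := f w)
    have := hdeg v
    have := hdeg w
    omega

/-- The diagonal form `X ^ 2 + d Y ^ 2` represents all units modulo powers of an odd prime not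
dividing `d`. -/
lemma exists_sq_add_mul_sq_modEq {p : ℕ} (hp : p.Prime) (hp2 : p ≠ 2) {d w : ℤ}
    (hd : ¬ (p : ℤ) ∣ d) (hw : ¬ (p : ℤ) ∣ w) (k : ℕ) :
    ∃ x y, x ^ 2 + d * y ^ 2 ≡ w [ZMOD (p ^ (k + 1) : ℕ)] := by
  have : Fact p.Prime := ⟨hp⟩
  have hp' : Prime (p : ℤ) := Nat.prime_iff_prime_int.mp hp
  have hd0 : (d : ZMod p) ≠ 0 := fun h => hd ((ZMod.intCast_zmod_eq_zero_iff_dvd _ _).mp h)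
  obtain ⟨x', y', hxy⟩ : ∃ x y : ZMod p, x ^ 2 + d * y ^ 2 = w := by
    open Polynomial in
    obtain ⟨x, y, h⟩ := FiniteField.exists_root_sum_quadratic
      (f := C 1 * X ^ 2 + C 0 * X + C (-(w : ZMod p))) (g := C (d : ZMod p) * X ^ 2 + C 0 * X + C 0)
      (degree_quadratic one_ne_zero) (degree_quadratic hd0) (by
        rw [ZMod.card]; exact (hp.eq_two_or_odd).resolve_left hp2)
    refine ⟨x, y, ?_⟩
    simp at h
    linear_combination h
  obtain ⟨x, rfl⟩ := ZMod.intCast_surjective x'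
  obtain ⟨y, rfl⟩ := ZMod.intCast_surjective y'
  have hxy' : x ^ 2 + d * y ^ 2 ≡ w [ZMOD p] := by
    rw [← ZMod.intCast_eq_intCast_iff]
    push_cast
    exact hxy
  by_cases hx : (p : ℤ) ∣ x
  · -- then `y` is a unit, and the equation is solved for `y`
    have hy : ¬ (p : ℤ) ∣ y := fun hy => hw (hxy'.dvd_iff.mp
      (dvd_add (hx.trans (dvd_pow_self x two_ne_zero)) ((hy.trans
        (dvd_pow_self y two_ne_zero)).mul_left d)))
    obtain ⟨e, f, hef⟩ := isCoprime_prime_pow hp hd (k + 1)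
    have hle : (p : ℤ) ∣ ((p ^ (k + 1) : ℕ) : ℤ) := by
      push_cast; exact dvd_pow_self _ (Nat.succ_ne_zero k)
    have h1 : y ^ 2 ≡ e * (w - x ^ 2) [ZMOD p] := by
      obtain ⟨g, hg⟩ := hle
      obtain ⟨r, hr⟩ := Int.modEq_iff_dvd.mp hxy'
      rw [hg] at hef
      refine Int.modEq_iff_dvd.mpr ⟨e * r - f * g * y ^ 2, ?_⟩
      linear_combination e * hr + y ^ 2 * hef
    obtain ⟨z, -, hz⟩ := exists_sq_modEq_prime_pow hp hp2 hy h1 k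
    refine ⟨x, z, ?_⟩
    obtain ⟨r, hr⟩ := Int.modEq_iff_dvd.mp hz
    exact Int.modEq_iff_dvd.mpr ⟨d * r + f * (w - x ^ 2), by
      linear_combination d * hr - (w - x ^ 2) * hef⟩
  · have h1 := hxy'.sub_right (d * y ^ 2)
    rw [add_sub_cancel_right] at h1
    obtain ⟨z, -, hz⟩ := exists_sq_modEq_prime_pow hp hp2 hx h1 k
    have h2 := hz.add_right (d * y ^ 2)
    rw [sub_add_cancel] at h2
    exact ⟨z, y, h2⟩

namespace Quad

/-- The circles tangent to the one of curvature `a` have curvatures `F (x, y) - a`, where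
`F (x, y) = (a + c) x ^ 2 + 6 t x y + 3 (a + b) y ^ 2`. -/
lemma move_C_B_C (s : Quad) (i j k : ℤ) :
    (((s.move .C i).move .B j).move .C k).c = (s.a + s.c) * (1 + 3 * j * k) ^ 2
      + 6 * s.t * (1 + 3 * j * k) * (i * (1 + 3 * j * k) + k)
      + 3 * (s.a + s.b) * (i * (1 + 3 * j * k) + k) ^ 2 - s.a := by
  simp only [move]
  ring

/-- If two curvatures of a triangle are not both divisible by `p`, then the curvature is not
constant modulo `p` along the chain of circles tangent to the two circles. -/
lemma not_dvd_of_valid {a b c t : ℤ} {p : ℕ} (hp : p.Prime) (hp5 : 5 ≤ p)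
    (h : 3 * t ^ 2 = a * b + b * c + c * a) (ha : ¬ (p : ℤ) ∣ a) :
    ¬ ((p : ℤ) ∣ 6 * t ∧ (p : ℤ) ∣ 3 * (a + b)) := by
  rintro ⟨h1, h2⟩
  have hp' : Prime (p : ℤ) := Nat.prime_iff_prime_int.mp hp
  have h6 : ¬ (p : ℤ) ∣ 6 := fun hd => by
    have hd' : p ∣ 6 := by exact_mod_cast hd
    have := Nat.le_of_dvd (by norm_num) hd'
    interval_cases p
    · omega
    · exact absurd hp (by norm_num)
  have ht : (p : ℤ) ∣ t := (hp'.dvd_or_dvd h1).resolve_left h6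
  have hb : (p : ℤ) ∣ a + b :=
    (hp'.dvd_or_dvd h2).resolve_left fun hd => h6 (hd.trans (by norm_num))
  apply ha
  have h3 : (p : ℤ) ∣ a ^ 2 := by
    have e : a ^ 2 = (a + b) * (a + c) - 3 * t * t := by linear_combination h
    rw [e]
    exact dvd_sub (hb.mul_right _) (ht.mul_left _)
  exact hp'.dvd_of_dvd_pow h3

/-- Away from `2` and `3`, there is no local obstruction. -/
lemma Valid.exists_reach_prime_pow {s : Quad} (hs : s.Valid) {p : ℕ} (hp : p.Prime) (hp5 : 5 ≤ p)
    (hprim : ¬ ((p : ℤ) ∣ s.a ∧ (p : ℤ) ∣ s.b ∧ (p : ℤ) ∣ s.c)) (N : ℤ) (k : ℕ) :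
    ∃ s', Reach s s' ∧ s'.c ≡ N [ZMOD (p ^ (k + 1) : ℕ)] := by
  have hp' : Prime (p : ℤ) := Nat.prime_iff_prime_int.mp hp
  have hp3 : ¬ (p : ℤ) ∣ 3 := fun hd => by
    have hd' : p ∣ 3 := by exact_mod_cast hd
    have := Nat.le_of_dvd (by norm_num) hd'
    omega
  -- make `b` a unit
  obtain ⟨s₁, hr₁, hb₁⟩ : ∃ s₁, Reach s s₁ ∧ ¬ (p : ℤ) ∣ s₁.b := by
    by_cases hb : (p : ℤ) ∣ s.b
    · have hv : 3 * s.t ^ 2 = s.a * s.b + s.b * s.c + s.c * s.a := hs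
      have hnd : ¬ ((p : ℤ) ∣ 6 * s.t ∧ (p : ℤ) ∣ 3 * (s.a + s.c)) := by
        by_cases ha : (p : ℤ) ∣ s.a
        · have := not_dvd_of_valid (a := s.c) (b := s.a) (c := s.b) (t := s.t) hp hp5
            (by rw [hv]; ring) (by tauto)
          rwa [add_comm] at this
        · exact not_dvd_of_valid (a := s.a) (b := s.c) (c := s.b) hp hp5 (by rw [hv]; ring) ha
      obtain ⟨j, hj, -⟩ := exists_avoid hp hp5 s.b (6 * s.t) (3 * (s.a + s.c)) 0 0 hnd
      rw [sub_zero] at hj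
      exact ⟨s.move .B j, .move _ _ .refl, hj⟩
    · exact ⟨s, .refl, hb⟩
  have hv₁ := hs.of_reach hr₁
  -- make `a` and `a + N` units
  obtain ⟨s₂, hr₂, ha₂, haN⟩ : ∃ s₂, Reach s₁ s₂ ∧ ¬ (p : ℤ) ∣ s₂.a ∧ ¬ (p : ℤ) ∣ s₂.a + N := by
    have hv : 3 * s₁.t ^ 2 = s₁.a * s₁.b + s₁.b * s₁.c + s₁.c * s₁.a := hv₁
    have hnd := not_dvd_of_valid (a := s₁.b) (b := s₁.c) (c := s₁.a) (t := s₁.t) hp hp5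
      (by rw [hv]; ring) hb₁
    obtain ⟨j, hj, hj'⟩ := exists_avoid hp hp5 s₁.a (6 * s₁.t) (3 * (s₁.b + s₁.c)) 0 (-N) hnd
    rw [sub_zero] at hj
    rw [sub_neg_eq_add] at hj'
    exact ⟨s₁.move .A j, .move _ _ .refl, hj, hj'⟩
  have hv₂ := hv₁.of_reach hr₂
  -- make `a + c` a unit
  obtain ⟨s₃, hr₃, ha₃, hu, haN₃⟩ : ∃ s₃, Reach s₂ s₃ ∧ ¬ (p : ℤ) ∣ s₃.a ∧
      ¬ (p : ℤ) ∣ s₃.a + s₃.c ∧ ¬ (p : ℤ) ∣ s₃.a + N := by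
    have hnd := not_dvd_of_valid hp hp5 hv₂ ha₂
    obtain ⟨j, hj, -⟩ := exists_avoid hp hp5 s₂.c (6 * s₂.t) (3 * (s₂.a + s₂.b)) (-s₂.a) 0 hnd
    refine ⟨s₂.move .C j, .move _ _ .refl, ha₂, ?_, haN⟩
    rw [sub_neg_eq_add, add_comm] at hj
    exact hj
  have hv₃ : 3 * s₃.t ^ 2 = s₃.a * s₃.b + s₃.b * s₃.c + s₃.c * s₃.a := hv₂.of_reach hr₃
  suffices h : ∃ s', Reach s₃ s' ∧ s'.c ≡ N [ZMOD (p ^ (k + 1) : ℕ)] by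
    obtain ⟨s', h1, h2⟩ := h
    exact ⟨s', hr₁.trans (hr₂.trans (hr₃.trans h1)), h2⟩
  -- solve `F (x, y) = a + N`, where `(a + c) F (x, y) = ((a + c) x + 3 t y) ^ 2 + 3 a ^ 2 y ^ 2`
  obtain ⟨X, y, hXy⟩ := exists_sq_add_mul_sq_modEq hp (by omega) (d := 3 * s₃.a ^ 2)
    (w := (s₃.a + s₃.c) * (s₃.a + N))
    (fun hd => by
      rcases hp'.dvd_or_dvd hd with h | h
      · exact hp3 h
      · exact ha₃ (hp'.dvd_of_dvd_pow h))
    (fun hd => by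
      rcases hp'.dvd_or_dvd hd with h | h
      · exact hu h
      · exact haN₃ h) k
  obtain ⟨e, f, hef⟩ := isCoprime_prime_pow hp hu (k + 1)
  obtain ⟨z, hz⟩ := Int.modEq_iff_dvd.mp hXy
  have hle : (p : ℤ) ∣ ((p ^ (k + 1) : ℕ) : ℤ) := by
    push_cast; exact dvd_pow_self _ (Nat.succ_ne_zero k)
  have hinv : ∀ w : ℤ, ¬ (p : ℤ) ∣ w → ∃ w', w * w' ≡ 1 [ZMOD (p ^ (k + 1) : ℕ)] := by
    intro w hw
    obtain ⟨u, v, huv⟩ := isCoprime_prime_pow hp hw (k + 1)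
    exact ⟨u, Int.modEq_iff_dvd.mpr ⟨v, by linear_combination -huv⟩⟩
  generalize ((p ^ (k + 1) : ℕ) : ℤ) = q at *
  obtain ⟨x, hx⟩ : ∃ x, x = e * (X - 3 * s₃.t * y) := ⟨_, rfl⟩
  have hF : (s₃.a + s₃.c) * x ^ 2 + 6 * s₃.t * x * y + 3 * (s₃.a + s₃.b) * y ^ 2 ≡ s₃.a + N
      [ZMOD q] := by
    have h1 : (s₃.a + s₃.c) * ((s₃.a + s₃.c) * x ^ 2 + 6 * s₃.t * x * y
        + 3 * (s₃.a + s₃.b) * y ^ 2) ≡ (s₃.a + s₃.c) * (s₃.a + N) [ZMOD q] := by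
      have h2 : (s₃.a + s₃.c) * x + 3 * s₃.t * y ≡ X [ZMOD q] :=
        Int.modEq_iff_dvd.mpr ⟨f * (X - 3 * s₃.t * y), by
          rw [hx]; linear_combination -(X - 3 * s₃.t * y) * hef⟩
      have h3 := ((h2.pow 2).add_right (3 * s₃.a ^ 2 * y ^ 2)).trans hXy
      refine Eq.trans ?_ h3
      congr 1
      linear_combination -3 * y ^ 2 * hv₃
    have h4 := h1.mul_left e
    have h5 : ∀ w, e * ((s₃.a + s₃.c) * w) ≡ w [ZMOD q] := fun w =>
      Int.modEq_iff_dvd.mpr ⟨f * w, by linear_combination -w * hef⟩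
    exact ((h5 _).symm.trans h4).trans (h5 _)
  -- choose parameters of three moves that lead to `(x, y)`
  obtain ⟨i, j, m, hX, hY⟩ : ∃ i j m, 1 + 3 * j * m ≡ x [ZMOD q] ∧
      i * (1 + 3 * j * m) + m ≡ y [ZMOD q] := by
    obtain ⟨w3, h3⟩ := hinv 3 hp3
    by_cases hy : (p : ℤ) ∣ y
    · have hxp : ¬ (p : ℤ) ∣ x := fun hxd => haN₃ ((hF.of_dvd hle).dvd_iff.mp (by
        refine dvd_add (dvd_add ?_ ?_) ?_
        · exact (hxd.trans (dvd_pow_self x two_ne_zero)).mul_left _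
        · exact hy.mul_left _
        · exact (hy.trans (dvd_pow_self y two_ne_zero)).mul_left _))
      obtain ⟨w, hw⟩ := hinv x hxp
      have e1 : 1 + 3 * (w3 * (x - 1)) * 1 ≡ x [ZMOD q] := by
        have := (h3.mul_right (x - 1)).add_left 1
        refine Eq.trans ?_ (this.trans ?_)
        · congr 1; ring
        · congr 1; ring
      refine ⟨w * (y - 1), w3 * (x - 1), 1, e1, ?_⟩
      have e2 := ((e1.mul_left (w * (y - 1))).add_right 1)
      refine e2.trans ?_
      have e3 := (hw.mul_right (y - 1)).add_right 1
      refine Eq.trans ?_ (e3.trans ?_)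
      · congr 1; ring
      · congr 1; ring
    · obtain ⟨w, hw⟩ := hinv y hy
      refine ⟨0, w3 * w * (x - 1), y, ?_, by simp⟩
      have := ((h3.mul hw).mul_right (x - 1)).add_left 1
      refine Eq.trans ?_ (this.trans ?_)
      · congr 1; ring
      · congr 1; ring
  refine ⟨((s₃.move .C i).move .B j).move .C m, .move _ _ (.move _ _ (.move _ _ .refl)), ?_⟩
  rw [move_C_B_C]
  have e1 := ((((hX.pow 2).mul_left (s₃.a + s₃.c)).add ((hX.mul_left (6 * s₃.t)).mul hY)).add
    ((hY.pow 2).mul_left (3 * (s₃.a + s₃.b)))).trans hF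
  simpa using e1.sub_right s₃.a

/-- At `2` the only obstruction is modulo `4`. -/
lemma exists_reach_two_pow {s : Quad} (ht : s.t % 2 = 1) (hab : (s.a + s.b) % 2 = 0) {N : ℤ}
    (hN : (N - s.c) % 4 = 0) (k : ℕ) : ∃ s', Reach s s' ∧ s'.c ≡ N [ZMOD (2 ^ k : ℕ)] := by
  obtain ⟨d, hd⟩ := Int.dvd_of_emod_eq_zero hN
  obtain ⟨i, hi⟩ := exists_modEq_of_isCoprime_quotient (q := 2 ^ k) (by positivity)
    (fun i => 3 * s.t * i + 3 * (s.a + s.b) * i ^ 2)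
    (fun i j => 3 * s.t + 3 * (s.a + s.b) * (i + j)) (fun i j => by ring)
    (fun i j => isCoprime_prime_pow Nat.prime_two (by
      have : (3 * (s.a + s.b) * (i + j)) % 2 = 0 := by
        rw [Int.mul_emod, Int.mul_emod 3, hab]; simp
      push_cast
      omega) k) d
  refine ⟨s.move .C (2 * i), .move _ _ .refl, ?_⟩
  have h := (hi.mul_left 4).add_left s.c
  refine Eq.trans ?_ (h.trans ?_)
  · congr 1; simp only [move]; ring
  · congr 1; linarith

/-- At `3` the only obstruction is modulo `9`, if `t` is a unit. -/
lemma exists_reach_three_pow {s : Quad} (ht : ¬ 3 ∣ s.t) {N : ℤ}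
    (hN : (N - s.c) % 9 = 0) (k : ℕ) : ∃ s', Reach s s' ∧ s'.c ≡ N [ZMOD (3 ^ k : ℕ)] := by
  obtain ⟨d, hd⟩ := Int.dvd_of_emod_eq_zero hN
  obtain ⟨i, hi⟩ := exists_modEq_of_isCoprime_quotient (q := 3 ^ k) (by positivity)
    (fun i => 2 * s.t * i + 3 * (s.a + s.b) * i ^ 2)
    (fun i j => 2 * s.t + 3 * ((s.a + s.b) * (i + j))) (fun i j => by ring)
    (fun i j => isCoprime_prime_pow Nat.prime_three (by push_cast; omega) k) d
  refine ⟨s.move .C (3 * i), .move _ _ .refl, ?_⟩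
  have h := (hi.mul_left 9).add_left s.c
  refine Eq.trans ?_ (h.trans ?_)
  · congr 1; simp only [move]; ring
  · congr 1; linarith

/-- The local conditions under which `N` is congruent to values of `c` modulo every number. -/
lemma Valid.exists_reach {s : Quad} (hs : s.Valid)
    (hprim : ∀ p : ℕ, p.Prime → ¬ ((p : ℤ) ∣ s.a ∧ (p : ℤ) ∣ s.b ∧ (p : ℤ) ∣ s.c))
    (hodd : s.a % 2 = 1 ∧ s.b % 2 = 1 ∧ s.c % 2 = 1) (ht : ¬ 3 ∣ s.t) {N : ℤ}
    (hN : (N - s.c) % 36 = 0) (M : ℕ) (hM : M ≠ 0) :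
    ∃ s', Reach s s' ∧ s'.c ≡ N [ZMOD M] := by
  refine exists_reach_modEq s N (fun p hp k => ?_) M hM
  have ht2 : s.t % 2 = 1 := by
    by_contra hc
    obtain ⟨u, hu⟩ : (2 : ℤ) ∣ s.t := by omega
    obtain ⟨a', ha'⟩ : ∃ a', s.a = 2 * a' + 1 := ⟨s.a / 2, by omega⟩
    obtain ⟨b', hb'⟩ : ∃ a', s.b = 2 * a' + 1 := ⟨s.b / 2, by omega⟩
    obtain ⟨c', hc'⟩ : ∃ a', s.c = 2 * a' + 1 := ⟨s.c / 2, by omega⟩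
    have hv : 3 * s.t ^ 2 = s.a * s.b + s.b * s.c + s.c * s.a := hs
    rw [hu, ha', hb', hc'] at hv
    have : (2 : ℤ) ∣ 3 := ⟨6 * u ^ 2 - (2 * a' * b' + 2 * b' * c' + 2 * c' * a'
      + 2 * a' + 2 * b' + 2 * c'), by linear_combination -hv⟩
    omega
  by_cases h2 : p = 2
  · subst h2
    exact exists_reach_two_pow ht2 (by omega) (by omega) k
  by_cases h3 : p = 3
  · subst h3
    exact exists_reach_three_pow ht (by omega) k
  rcases k with _ | k
  · exact ⟨s, .refl, by simpa using Int.modEq_one⟩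
  refine hs.exists_reach_prime_pow hp ?_ (hprim p hp) N k
  have := hp.two_le
  by_contra hlt
  have h4 : p = 4 := by omega
  subst h4
  exact absurd hp (by norm_num)

end Quad

/-! ### Values admissible modulo every number -/

/-- `l'` is the pullback of `l` along some symmetry. -/
def IsPullback (l' l : NullForm) : Prop :=
  ∃ φ, IsSymmetry φ ∧ ∀ D, l'.eval D = l.eval (φ D)

namespace IsPullback

variable {l l' l'' : NullForm}

lemma refl (l : NullForm) : IsPullback l l := ⟨id, .id, fun _ => rfl⟩

lemma trans (h : IsPullback l'' l') (h' : IsPullback l' l) : IsPullback l'' l := by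
  obtain ⟨φ, hφ, h⟩ := h
  obtain ⟨ψ, hψ, h'⟩ := h'
  exact ⟨ψ ∘ φ, hψ.comp hφ, fun D => by rw [h, h']; rfl⟩

lemma isRegular (h : IsPullback l' l) (hl : IsRegular l) : IsRegular l' := by
  obtain ⟨φ, hφ, h⟩ := h
  exact hl.pull hφ h

lemma exists_eval_eq (h : IsPullback l' l) {D : LatticeVector} (hD : Orbit D) :
    ∃ D', Orbit D' ∧ l.eval D' = l'.eval D := by
  obtain ⟨φ, hφ, h⟩ := h
  exact ⟨φ D, hφ.orbit D hD, (h D).symm⟩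

end IsPullback

namespace NullForm

/-- The quadruple of the base triangle. -/
def quad (l : NullForm) : Quad := ⟨l.a, l.b, l.c, l.t⟩

lemma exists_swapAB (l : NullForm) :
    ∃ l', IsPullback l' l ∧ l'.a = l.b ∧ l'.b = l.a ∧ l'.c = l.c ∧ l'.t = l.t := by
  obtain ⟨l', h⟩ := isSymmetry_swapAB.pull l
  exact ⟨l', ⟨_, isSymmetry_swapAB, h⟩, pull_swapAB h⟩

lemma exists_swapBC (l : NullForm) :
    ∃ l', IsPullback l' l ∧ l'.a = l.a ∧ l'.b = l.c ∧ l'.c = l.b ∧ l'.t = l.t := by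
  obtain ⟨l', h⟩ := isSymmetry_swapBC.pull l
  exact ⟨l', ⟨_, isSymmetry_swapBC, h⟩, pull_swapBC h⟩

lemma exists_swapAC (l : NullForm) :
    ∃ l', IsPullback l' l ∧ l'.a = l.c ∧ l'.b = l.b ∧ l'.c = l.a ∧ l'.t = l.t := by
  obtain ⟨l₁, h₁, a₁, b₁, c₁, t₁⟩ := l.exists_swapAB
  obtain ⟨l₂, h₂, a₂, b₂, c₂, t₂⟩ := l₁.exists_swapBC
  obtain ⟨l₃, h₃, a₃, b₃, c₃, t₃⟩ := l₂.exists_swapAB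
  exact ⟨l₃, h₃.trans (h₂.trans h₁), by rw [a₃, b₂, c₁], by rw [b₃, a₂, a₁],
    by rw [c₃, c₂, b₁], by rw [t₃, t₂, t₁]⟩

lemma exists_moveC (l : NullForm) (j : ℤ) :
    ∃ l', IsPullback l' l ∧ l'.quad = l.quad.move .C j := by
  obtain ⟨φ, hφ, -, -, l', h, ha, hb, hc, ht⟩ := l.exists_chain j
  exact ⟨l', ⟨φ, hφ, h⟩, Quad.ext ha hb hc ht⟩

/-- The moves come from symmetries. -/
lemma exists_move (l : NullForm) (i : Corner) (j : ℤ) :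
    ∃ l', IsPullback l' l ∧ l'.quad = l.quad.move i j := by
  cases i with
  | C => exact l.exists_moveC j
  | A =>
    obtain ⟨l₁, h₁, a₁, b₁, c₁, t₁⟩ := l.exists_swapAC
    obtain ⟨φ, hφ, -, -, l₂, h₂, a₂, b₂, c₂, t₂⟩ := l₁.exists_chain j
    obtain ⟨l₃, h₃, a₃, b₃, c₃, t₃⟩ := l₂.exists_swapAC
    refine ⟨l₃, h₃.trans (.trans ⟨φ, hφ, h₂⟩ h₁), ?_⟩
    ext <;> simp only [quad, Quad.move, a₃, b₃, c₃, t₃, a₂, b₂, c₂, t₂, a₁, b₁, c₁, t₁] <;> ring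
  | B =>
    obtain ⟨l₁, h₁, a₁, b₁, c₁, t₁⟩ := l.exists_swapBC
    obtain ⟨φ, hφ, -, -, l₂, h₂, a₂, b₂, c₂, t₂⟩ := l₁.exists_chain j
    obtain ⟨l₃, h₃, a₃, b₃, c₃, t₃⟩ := l₂.exists_swapBC
    refine ⟨l₃, h₃.trans (.trans ⟨φ, hφ, h₂⟩ h₁), ?_⟩
    ext <;> simp only [quad, Quad.move, a₃, b₃, c₃, t₃, a₂, b₂, c₂, t₂, a₁, b₁, c₁, t₁]

lemma exists_of_reach (l : NullForm) {s : Quad} (h : Quad.Reach l.quad s) :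
    ∃ l', IsPullback l' l ∧ l'.quad = s := by
  induction h with
  | refl => exact ⟨l, .refl l, rfl⟩
  | move i j _ ih =>
    obtain ⟨l₁, h₁, rfl⟩ := ih
    obtain ⟨l₂, h₂, e⟩ := l₁.exists_move i j
    exact ⟨l₂, h₂.trans h₁, e⟩

end NullForm

namespace IsRegular

variable {l : NullForm}

lemma exists_eval_modEq (hl : IsRegular l) (ht : ¬ 3 ∣ l.t) {N : ℤ} (hN : (N - l.c) % 36 = 0)
    (M : ℕ) (hM : M ≠ 0) : ∃ D, Orbit D ∧ N ≡ l.eval D [ZMOD M] := by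
  have hmod := hl.mod_three
  obtain ⟨s, hs, hsN⟩ := Quad.Valid.exists_reach (s := l.quad) l.descartes
    (fun p hp h => hl.not_dvd_all hp h.1 h.2.1 h.2.2)
    (show l.a % 2 = 1 ∧ l.b % 2 = 1 ∧ l.c % 2 = 1 by omega) ht hN M hM
  obtain ⟨l', hl', rfl⟩ := l.exists_of_reach hs
  obtain ⟨D, hD, hDe⟩ := hl'.exists_eval_eq (Orbit.of_vertex 0 1)
  exact ⟨D, hD, by rw [hDe]; exact hsN.symm⟩

/-- A step along the chain of circles tangent to the circles of curvatures `a` and `b` makes `t` a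
unit at `3`. -/
lemma exists_not_three_dvd_t (l : NullForm) (hab : ¬ 3 ∣ l.a + l.b) :
    ∃ l', IsPullback l' l ∧ l'.a = l.a ∧ l'.b = l.b ∧ ¬ 3 ∣ l'.t := by
  by_cases ht : 3 ∣ l.t
  · obtain ⟨φ, hφ, -, -, l', h, ha, hb, -, ht'⟩ := l.exists_chain 1
    exact ⟨l', ⟨φ, hφ, h⟩, ha, hb, by rw [ht']; omega⟩
  · exact ⟨l, .refl l, rfl, rfl, ht⟩

/-- In type `(1)` there are arbitrarily large squares that are congruent to curvatures modulo every
number. -/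
lemma exists_large_sq (hl : IsRegular l) (h1 : ∀ D, Orbit D → l.eval D % 12 = 1) (Z : ℤ) :
    ∃ n : ℤ, Z ≤ n ^ 2 ∧ ∀ M : ℕ, M ≠ 0 → ∃ D, Orbit D ∧ n ^ 2 ≡ l.eval D [ZMOD M] := by
  have ha : l.a % 12 = 1 := h1 _ (.of_vertex 0 0)
  have hb : l.b % 12 = 1 := h1 _ (.of_vertex 1 0)
  obtain ⟨l', hl', -, -, ht⟩ := exists_not_three_dvd_t l (by omega)
  have hc : l'.c % 12 = 1 := by
    obtain ⟨D, hD, he⟩ := hl'.exists_eval_eq (Orbit.of_vertex 0 1)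
    rw [NullForm.c, ← he]
    exact h1 D hD
  -- the residue classes `1`, `25` and `13` modulo `36` are those of `1 ^ 2`, `5 ^ 2` and `7 ^ 2`
  obtain ⟨n₀, hn₀⟩ : ∃ n₀ : ℤ, (n₀ ^ 2 - l'.c) % 36 = 0 := by
    have h3 : l'.c % 36 = 1 ∨ l'.c % 36 = 13 ∨ l'.c % 36 = 25 := by omega
    rcases h3 with h | h | h
    · exact ⟨1, by omega⟩
    · exact ⟨7, by omega⟩
    · exact ⟨5, by omega⟩
  obtain ⟨r, hr⟩ : ∃ r, r = |Z| + |n₀| := ⟨_, rfl⟩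
  refine ⟨n₀ + 36 * r, ?_, fun M hM => ?_⟩
  · have := abs_nonneg Z
    have := abs_nonneg n₀
    have := le_abs_self Z
    have := neg_abs_le n₀
    nlinarith
  · have hN : ((n₀ + 36 * r) ^ 2 - l'.c) % 36 = 0 := by
      have e : (n₀ + 36 * r) ^ 2 - l'.c = (n₀ ^ 2 - l'.c) + 36 * (2 * n₀ * r + 36 * r ^ 2) := by
        ring
      rw [e]; omega
    obtain ⟨D, hD, hDN⟩ := (hl'.isRegular hl).exists_eval_modEq ht hN M hM
    obtain ⟨D', hD', he⟩ := hl'.exists_eval_eq hD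
    exact ⟨D', hD', by rwa [he]⟩

/-- In type `(3, 11)` there are arbitrarily large numbers `3 n ^ 2` that are congruent to curvatures
modulo every number. -/
lemma exists_large_three_mul_sq (hl : IsRegular l)
    (h1 : ∀ D, Orbit D → l.eval D % 12 = 3 ∨ l.eval D % 12 = 11) (Z : ℤ) :
    ∃ n : ℤ, Z ≤ 3 * n ^ 2 ∧ ∀ M : ℕ, M ≠ 0 → ∃ D, Orbit D ∧ 3 * n ^ 2 ≡ l.eval D [ZMOD M] := by
  -- reorder such that `b` is the curvature not divisible by `3`
  obtain ⟨l₁, hl₁, ha₁, hb₁⟩ : ∃ l', IsPullback l' l ∧ l'.a % 12 = 3 ∧ l'.b % 12 = 11 := by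
    have ha : l.a % 12 = 3 ∨ l.a % 12 = 11 := h1 _ (.of_vertex 0 0)
    rcases hl.mod_three with h | h | h | h
    · omega
    · obtain ⟨l', hl', a', b', -⟩ := l.exists_swapBC
      exact ⟨l', hl', by omega, by omega⟩
    · exact ⟨l, .refl l, h.1, h.2.1⟩
    · obtain ⟨l', hl', a', b', -⟩ := l.exists_swapAB
      exact ⟨l', hl', by omega, by omega⟩
  obtain ⟨l₂, hl₂, ha₂, hb₂, ht₂⟩ := exists_not_three_dvd_t l₁ (by omega)
  have hmod := ((hl₂.trans hl₁).isRegular hl).mod_three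
  -- the relation between `t` and the curvatures modulo `9`
  have hsum : (l₂.a + l₂.c) % 9 = 6 := by
    have hd := l₂.descartes
    obtain ⟨a', ha'⟩ : ∃ a', l₂.a = 3 * a' := ⟨l₂.a / 3, by omega⟩
    obtain ⟨c', hc'⟩ : ∃ c', l₂.c = 3 * c' := ⟨l₂.c / 3, by omega⟩
    obtain ⟨b', hb'⟩ : ∃ b', l₂.b = 3 * b' + 2 := ⟨l₂.b / 3, by omega⟩
    rw [ha', hb', hc'] at hd
    rw [ha', hc']
    obtain ⟨u, hu | hu⟩ : ∃ u, l₂.t = 3 * u + 1 ∨ l₂.t = 3 * u + 2 := ⟨l₂.t / 3, by omega⟩ <;>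
    · rw [hu] at hd
      ring_nf at hd
      omega
  obtain ⟨l', hl', ht, hc12, hc⟩ : ∃ l', IsPullback l' l ∧ ¬ 3 ∣ l'.t ∧ l'.c % 12 = 3 ∧
      (l'.c % 9 = 0 ∨ l'.c % 9 = 3) := by
    by_cases hc : l₂.c % 9 = 0 ∨ l₂.c % 9 = 3
    · exact ⟨l₂, hl₂.trans hl₁, ht₂, by omega, hc⟩
    · obtain ⟨l', hl', a', b', c', t'⟩ := l₂.exists_swapAC
      exact ⟨l', hl'.trans (hl₂.trans hl₁), by rwa [t'], by omega, by omega⟩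
  obtain ⟨n₀, hn₀⟩ : ∃ n₀ : ℤ, (3 * n₀ ^ 2 - l'.c) % 36 = 0 := by
    rcases hc with h | h
    · exact ⟨3, by omega⟩
    · exact ⟨1, by omega⟩
  obtain ⟨r, hr⟩ : ∃ r, r = |Z| + |n₀| := ⟨_, rfl⟩
  refine ⟨n₀ + 36 * r, ?_, fun M hM => ?_⟩
  · have := abs_nonneg Z
    have := abs_nonneg n₀
    have := le_abs_self Z
    have := neg_abs_le n₀
    nlinarith
  · have hN : (3 * (n₀ + 36 * r) ^ 2 - l'.c) % 36 = 0 := by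
      have e : 3 * (n₀ + 36 * r) ^ 2 - l'.c
          = (3 * n₀ ^ 2 - l'.c) + 36 * (6 * n₀ * r + 108 * r ^ 2) := by
        ring
      rw [e]; omega
    obtain ⟨D, hD, hDN⟩ := ((hl'.isRegular hl)).exists_eval_modEq ht hN M hM
    obtain ⟨D', hD', he⟩ := hl'.exists_eval_eq hD
    exact ⟨D', hD', by rwa [he]⟩

end IsRegular

/-! ### From circles to lattice vectors -/

/-- The oriented circle `C` has the coordinates given by `D`. -/
structure Represents (D : LatticeVector) (C : OrientedCircle) : Prop where
  cocurvature : C.cocurvature = 4 * D.f - D.e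
  curvature : C.curvature = D.e
  re : C.h.re = 2 * D.m + D.n
  im : C.h.im = √3 * D.n

/-- The oriented circle `C` is `√3 / 12` times the vector `Δ.root`, that is the incircle of `Δ`. -/
structure RepresentsIncircle (Δ : Triangle) (C : OrientedCircle) : Prop where
  cocurvature : C.cocurvature = √3 * (4 * Δ.height + 1)
  curvature : C.curvature = √3
  re : C.h.re = √3 * (2 * (Δ.x : ℝ) + Δ.y + Δ.i)
  im : C.h.im = 3 * (Δ.y : ℝ) + Δ.i

lemma inversiveProduct_eq (C D : OrientedCircle) : C.inversiveProduct D
    = C.h.re * D.h.re + C.h.im * D.h.im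
      - (C.curvature * D.cocurvature + D.curvature * C.cocurvature) / 2 := by
  simp [OrientedCircle.inversiveProduct]

lemma sqrt_three_sq : (√3 : ℝ) ^ 2 = 3 := Real.sq_sqrt (by norm_num)

lemma Represents.inversiveProduct {D D' : LatticeVector} {C C' : OrientedCircle}
    (h : Represents D C) (h' : Represents D' C') : C.inversiveProduct C' = inner D D' := by
  rw [inversiveProduct_eq, h.cocurvature, h.curvature, h.re, h.im, h'.cocurvature, h'.curvature,
    h'.re, h'.im, inner]
  push_cast
  linear_combination (D.n : ℝ) * D'.n * sqrt_three_sq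

lemma Represents.reflect {D : LatticeVector} {Δ : Triangle} {C E : OrientedCircle}
    (h : Represents D C) (hE : RepresentsIncircle Δ E) :
    Represents (Δ.reflect D) (E.reflect C) := by
  have hp : C.inversiveProduct E = 2 * √3 * Δ.pair D := by
    rw [inversiveProduct_eq, h.cocurvature, h.curvature, h.re, h.im, hE.cocurvature, hE.curvature,
      hE.re, hE.im, Triangle.pair]
    push_cast
    ring
  constructor
  · simp only [OrientedCircle.reflect, hp, h.cocurvature, hE.cocurvature, Triangle.reflect,
      Triangle.root]
    push_cast
    linear_combination -4 * (Δ.pair D : ℝ) * (4 * Δ.height + 1) * sqrt_three_sq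
  · simp only [OrientedCircle.reflect, hp, h.curvature, hE.curvature, Triangle.reflect,
      Triangle.root]
    push_cast
    linear_combination -4 * (Δ.pair D : ℝ) * sqrt_three_sq
  · simp only [OrientedCircle.reflect, hp, Complex.sub_re, Complex.re_ofReal_mul, h.re, hE.re,
      Triangle.reflect, Triangle.root]
    push_cast
    linear_combination -4 * (Δ.pair D : ℝ) * (2 * (Δ.x : ℝ) + Δ.y + Δ.i) * sqrt_three_sq
  · simp only [OrientedCircle.reflect, hp, Complex.sub_im, Complex.im_ofReal_mul, h.im, hE.im,
      Triangle.reflect, Triangle.root]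
    push_cast
    ring

lemma Represents.unique {D : LatticeVector} {C C' : OrientedCircle} (h : Represents D C)
    (h' : Represents D C') : C = C' := by
  ext1
  · rw [h.cocurvature, h'.cocurvature]
  · rw [h.curvature, h'.curvature]
  · exact Complex.ext (by rw [h.re, h'.re]) (by rw [h.im, h'.im])

lemma represents_vertex (m n : ℤ) : Represents (vertex m n)
    (OrientedCircle.ofCenterRadius (gridPoint m n) 1 one_pos) := by
  constructor
  · simp only [OrientedCircle.ofCenterRadius, gridPoint, Complex.normSq_apply, vertex,
      eisensteinNorm]
    push_cast
    linear_combination (n : ℝ) ^ 2 * sqrt_three_sq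
  · simp [OrientedCircle.ofCenterRadius, vertex]
  · simp [OrientedCircle.ofCenterRadius, gridPoint, vertex]
  · simp [OrientedCircle.ofCenterRadius, gridPoint, vertex]

lemma representsIncircle_of_center (Δ : Triangle) (z : ℂ)
    (hre : z.re = 2 * (Δ.x : ℝ) + Δ.y + Δ.i) (him : 3 * z.im = √3 * (3 * (Δ.y : ℝ) + Δ.i)) :
    RepresentsIncircle Δ (OrientedCircle.ofCenterRadius z (1 / √3) (by positivity)) := by
  have hs := sqrt_three_sq
  have h0 : (√3 : ℝ) ≠ 0 := by positivity
  have hi : (Δ.i : ℝ) ^ 2 = 1 := by exact_mod_cast Δ.i_sq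
  have him' : z.im = √3 * (3 * (Δ.y : ℝ) + Δ.i) / 3 := by linarith
  have hdiv : z / ((1 / √3 : ℝ) : ℂ) = ((√3 : ℝ) : ℂ) * z := by
    have : ((√3 : ℝ) : ℂ) ≠ 0 := by exact_mod_cast h0
    push_cast
    field_simp
  constructor
  · simp only [OrientedCircle.ofCenterRadius, Complex.normSq_apply, hre, him', Triangle.height,
      eisensteinNorm]
    push_cast
    rw [one_div, inv_pow, hs, div_inv_eq_mul]
    linear_combination √3 * (3 * (Δ.y : ℝ) + Δ.i) ^ 2 / 9 * hs + 4 / 3 * √3 * hi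
  · simp [OrientedCircle.ofCenterRadius]
  · simp only [OrientedCircle.ofCenterRadius, hdiv, Complex.re_ofReal_mul, hre]
  · simp only [OrientedCircle.ofCenterRadius, hdiv, Complex.im_ofReal_mul, him']
    linear_combination (3 * (Δ.y : ℝ) + Δ.i) / 3 * hs

lemma exists_triangle_of_mem_gridDual {E : OrientedCircle} (hE : E ∈ gridDual) :
    ∃ Δ, RepresentsIncircle Δ E := by
  obtain ⟨m, n, rfl | rfl⟩ := hE
  · refine ⟨⟨m, n, 1, Or.inl rfl⟩, representsIncircle_of_center _ _ ?_ ?_⟩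
    · simp [gridPoint]; ring
    · simp [gridPoint]; ring
  · refine ⟨⟨m + 1, n + 1, -1, Or.inr rfl⟩, representsIncircle_of_center _ _ ?_ ?_⟩
    · simp [gridPoint]; ring
    · simp [gridPoint]; ring

lemma exists_mem_gridDual (Δ : Triangle) : ∃ E ∈ gridDual, RepresentsIncircle Δ E := by
  obtain ⟨x, y, i, rfl | rfl⟩ := Δ
  · refine ⟨_, ⟨x, y, Or.inl rfl⟩, representsIncircle_of_center _ _ ?_ ?_⟩
    · simp [gridPoint]; ring
    · simp [gridPoint]; ring
  · refine ⟨_, ⟨x - 1, y - 1, Or.inr rfl⟩, representsIncircle_of_center _ _ ?_ ?_⟩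
    · simp [gridPoint]; ring
    · simp [gridPoint]; ring

lemma exists_represents_of_orbit {C : OrientedCircle}
    (hC : ApollonianOrbit gridBase gridDual C) : ∃ D, Orbit D ∧ Represents D C := by
  induction hC with
  | of_base hC =>
    obtain ⟨m, n, rfl⟩ := hC
    exact ⟨vertex m n, .of_vertex m n, represents_vertex m n⟩
  | reflect hE _ ih =>
    obtain ⟨D, hD, hDC⟩ := ih
    obtain ⟨Δ, hΔ⟩ := exists_triangle_of_mem_gridDual hE
    exact ⟨Δ.reflect D, .of_reflect Δ hD, hDC.reflect hΔ⟩

lemma Orbit.exists_apollonianOrbit {D : LatticeVector} (hD : Orbit D) :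
    ∃ C, ApollonianOrbit gridBase gridDual C ∧ Represents D C := by
  induction hD with
  | of_vertex m n => exact ⟨_, .of_base ⟨m, n, rfl⟩, represents_vertex m n⟩
  | @of_reflect Δ D _ ih =>
    obtain ⟨C, hC, hDC⟩ := ih
    obtain ⟨E, hE, hΔ⟩ := exists_mem_gridDual Δ
    exact ⟨E.reflect C, .reflect hE hC, hDC.reflect hΔ⟩

/-! ### Möbius transformations -/

lemma inversiveProduct_moebius (g : SL(2, ℂ)) (C D : OrientedCircle) :
    (C.moebius g).inversiveProduct (D.moebius g) = C.inversiveProduct D := by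
  have hN : Complex.normSq (g 1 1 * g 0 0 - -g 0 1 * -g 1 0) = 1 := by
    have h1 := g.det_coe
    rw [Matrix.det_fin_two] at h1
    rw [show g 1 1 * g 0 0 - -g 0 1 * -g 1 0 = 1 by linear_combination h1]
    simp
  simp only [inversiveProduct_eq, OrientedCircle.moebius]
  generalize g 1 1 = p at *
  generalize -g 0 1 = q at *
  generalize -g 1 0 = r at *
  generalize g 0 0 = s at *
  simp only [Complex.normSq_apply, Complex.sub_re, Complex.sub_im, Complex.add_re,
    Complex.add_im, Complex.mul_re, Complex.mul_im, Complex.conj_re, Complex.conj_im,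
    Complex.ofReal_re, Complex.ofReal_im] at hN ⊢
  linear_combination (C.h.re * D.h.re + C.h.im * D.h.im
      - (C.curvature * D.cocurvature + D.curvature * C.cocurvature) / 2) * hN

lemma moebius_reflect (g : SL(2, ℂ)) (E C : OrientedCircle) :
    (E.reflect C).moebius g = (E.moebius g).reflect (C.moebius g) := by
  have hp := inversiveProduct_moebius g C E
  ext1
  · simp only [OrientedCircle.reflect]
    rw [hp]
    simp only [OrientedCircle.moebius, Complex.sub_re, Complex.sub_im,
      Complex.mul_re, Complex.mul_im, Complex.conj_re, Complex.conj_im, Complex.ofReal_re,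
      Complex.ofReal_im]
    ring
  · simp only [OrientedCircle.reflect]
    rw [hp]
    simp only [OrientedCircle.moebius, Complex.sub_re, Complex.sub_im,
      Complex.mul_re, Complex.mul_im, Complex.conj_re, Complex.conj_im, Complex.ofReal_re,
      Complex.ofReal_im]
    ring
  · simp only [OrientedCircle.reflect]
    rw [hp]
    simp only [OrientedCircle.moebius, map_sub, map_mul, Complex.conj_ofReal, Complex.ofReal_sub,
      Complex.ofReal_mul]
    ring

lemma apollonianOrbit_moebius_iff (g : SL(2, ℂ)) (base dual : Set OrientedCircle)
    (C : OrientedCircle) :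
    ApollonianOrbit (OrientedCircle.moebius g '' base) (OrientedCircle.moebius g '' dual) C ↔
      ∃ C', ApollonianOrbit base dual C' ∧ C'.moebius g = C := by
  constructor
  · intro h
    induction h with
    | of_base hC =>
      obtain ⟨C', hC', rfl⟩ := hC
      exact ⟨C', .of_base hC', rfl⟩
    | reflect hE _ ih =>
      obtain ⟨C', hC', rfl⟩ := ih
      obtain ⟨E, hE, rfl⟩ := hE
      exact ⟨E.reflect C', .reflect hE hC', moebius_reflect g E C'⟩
  · rintro ⟨C', h, rfl⟩
    induction h with
    | of_base hC => exact .of_base ⟨_, hC, rfl⟩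
    | reflect hE _ ih =>
      rw [moebius_reflect]
      exact .reflect ⟨_, hE, rfl⟩ ih

/-- The curvature is the product with the image of the point at infinity, a null vector. -/
lemma exists_curvature_moebius (g : SL(2, ℂ)) : ∃ A B U W : ℝ,
    3 * B * (4 * A + B) = 4 * (U ^ 2 - U * W + W ^ 2) ∧ 0 ≤ B ∧ 0 ≤ 4 * A + B ∧
      ∀ D C, Represents D C →
        (C.moebius g).curvature = A * D.e + B * D.f + U * D.m + W * D.n := by
  refine ⟨Complex.normSq (g 1 1) - Complex.normSq (-g 1 0), 4 * Complex.normSq (-g 1 0),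
    -4 * (g 1 1 * conj (-g 1 0)).re,
    -2 * (g 1 1 * conj (-g 1 0)).re - 2 * √3 * (g 1 1 * conj (-g 1 0)).im, ?_, ?_, ?_, ?_⟩
  · have h : Complex.normSq (g 1 1) * Complex.normSq (-g 1 0)
        = (g 1 1 * conj (-g 1 0)).re ^ 2 + (g 1 1 * conj (-g 1 0)).im ^ 2 := by
      rw [← Complex.normSq_conj (-g 1 0), ← Complex.normSq_mul, Complex.normSq_apply]
      ring
    linear_combination 48 * h - 16 * (g 1 1 * conj (-g 1 0)).im ^ 2 * sqrt_three_sq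
  · exact mul_nonneg (by norm_num) (Complex.normSq_nonneg _)
  · have := Complex.normSq_nonneg (g 1 1)
    linarith
  · intro D C h
    have e : (conj C.h * g 1 1 * conj (-g 1 0)).re
        = C.h.re * (g 1 1 * conj (-g 1 0)).re + C.h.im * (g 1 1 * conj (-g 1 0)).im := by
      rw [mul_assoc, Complex.mul_re, Complex.conj_re, Complex.conj_im]
      ring
    simp only [OrientedCircle.moebius]
    rw [e, h.cocurvature, h.curvature, h.re, h.im]
    ring

/-- The curvatures of an integral packing are the values of a null form, whose null vector lies in
the closure of the future cone. -/
lemma exists_nullForm {g : SL(2, ℂ)}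
    (hint : ∀ D C, Orbit D → Represents D C → ∃ n : ℤ, (C.moebius g).curvature = n) :
    ∃ l : NullForm, 0 ≤ l.k ∧ 0 ≤ 2 * l.A + l.k ∧
      ∀ D C, Represents D C → (C.moebius g).curvature = l.eval D := by
  obtain ⟨A, B, U, W, hnull, hB, hAB, hcurv⟩ := exists_curvature_moebius g
  have hv : ∀ m n : ℤ, ∃ v : ℤ, A + B * eisensteinNorm m n + U * m + W * n = v := by
    intro m n
    obtain ⟨v, hv⟩ := hint _ _ (.of_vertex m n) (represents_vertex m n)
    rw [hcurv _ _ (represents_vertex m n)] at hv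
    exact ⟨v, by rw [← hv]; simp [vertex]⟩
  obtain ⟨v₀, h₀⟩ := hv 0 0
  obtain ⟨v₁, h₁⟩ := hv 1 0
  obtain ⟨v₂, h₂⟩ := hv 0 1
  obtain ⟨v₃, h₃⟩ := hv 1 1
  simp [eisensteinNorm] at h₀ h₁ h₂ h₃
  obtain ⟨β, rfl⟩ : ∃ β : ℤ, B = β := ⟨v₃ - v₁ - v₂ + v₀, by push_cast; linarith⟩
  obtain rfl : A = v₀ := h₀
  obtain ⟨u, rfl⟩ : ∃ u : ℤ, U = u := ⟨v₁ - v₀ - β, by push_cast; linarith⟩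
  obtain ⟨w, rfl⟩ : ∃ w : ℤ, W = w := ⟨v₂ - v₀ - β, by push_cast; linarith⟩
  have hnull' : 3 * β * (4 * v₀ + β) = 4 * (u ^ 2 - u * w + w ^ 2) := by exact_mod_cast hnull
  have hβ : (2 : ℤ) ∣ β := by
    have h : (2 : ℤ) ∣ β ^ 2 :=
      ⟨2 * (u ^ 2 - u * w + w ^ 2) - 6 * β * v₀ - β ^ 2, by linear_combination hnull'⟩
    exact Int.prime_two.dvd_of_dvd_pow h
  obtain ⟨k, rfl⟩ := hβ
  refine ⟨⟨v₀, k, u, w, by linarith⟩, ?_, ?_, fun D C h => ?_⟩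
  · have : (0 : ℤ) ≤ 2 * k := by exact_mod_cast hB
    simp only; omega
  · have : (0 : ℤ) ≤ 4 * v₀ + 2 * k := by exact_mod_cast hAB
    simp only; omega
  · rw [hcurv D C h, NullForm.eval]
    push_cast
    ring

lemma Orbit.inner_self {D : LatticeVector} (hD : Orbit D) : inner D D = 1 := by
  obtain ⟨φ, hφ, rfl⟩ := hD.exists_isSymmetry
  rw [hφ.inner_eq]
  decide

/-- Two tangent circles have nonnegative curvature sum: their sum is a null vector in the closure of
the future cone. -/
lemma NullForm.add_nonneg_of_tangent (l : NullForm) (hk : 0 ≤ l.k) (hA : 0 ≤ 2 * l.A + l.k)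
    {C D : LatticeVector} (hC : Orbit C) (hD : Orbit D) (h : inner C D = -1) :
    0 ≤ l.eval C + l.eval D := by
  have hC1 := hC.inner_self
  have hD1 := hD.inner_self
  have hF : 0 ≤ C.f + D.f := add_nonneg hC.reducedOrbit.f_nonneg hD.reducedOrbit.f_nonneg
  have hsum : l.eval C + l.eval D = l.A * (C.e + D.e) + 2 * l.k * (C.f + D.f)
      + l.U * (C.m + D.m) + l.W * (C.n + D.n) := by
    simp only [eval]; ring
  have hnull : (C.e + D.e) * (4 * (C.f + D.f) - (C.e + D.e))
      = 4 * ((C.m + D.m) ^ 2 + (C.m + D.m) * (C.n + D.n) + (C.n + D.n) ^ 2) := by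
    simp only [inner] at h hC1 hD1
    linear_combination -hC1 - hD1 - 2 * h
  rw [hsum]
  generalize C.e + D.e = E at *
  generalize C.f + D.f = F at *
  generalize C.m + D.m = M at *
  generalize C.n + D.n = N at *
  have hl := l.null
  have hMN : 0 ≤ M ^ 2 + M * N + N ^ 2 := eisensteinNorm_nonneg M N
  have hE : 0 ≤ E := by
    by_contra hc
    nlinarith
  have hQ : 0 ≤ 4 * F - E := by
    by_contra hc
    nlinarith
  -- the Cauchy–Schwarz inequality for the norm form and its dual
  have hCS : 3 * (l.U * M + l.W * N) ^ 2
      ≤ 4 * (l.U ^ 2 - l.U * l.W + l.W ^ 2) * (M ^ 2 + M * N + N ^ 2) := by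
    nlinarith [sq_nonneg (l.U * (M + 2 * N) - l.W * (2 * M + N))]
  have hCS' : (2 * (l.U * M + l.W * N)) ^ 2 ≤ ((2 * l.A + l.k) * E + l.k * (4 * F - E)) ^ 2 := by
    have e : 4 * (l.U ^ 2 - l.U * l.W + l.W ^ 2) * (M ^ 2 + M * N + N ^ 2)
        = 3 * (l.k * (2 * l.A + l.k) * (E * (4 * F - E))) := by rw [← hl, hnull]; ring
    rw [e] at hCS
    linarith [sq_nonneg ((2 * l.A + l.k) * E - l.k * (4 * F - E))]
  have h2 := neg_le_of_abs_le (abs_le_of_sq_le_sq hCS'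
    (add_nonneg (mul_nonneg hA hE) (mul_nonneg hk hQ)))
  linarith

end TriangularPacking

/-! ### Squares among the curvatures -/

open TriangularPacking in
theorem mainTheorem5 (A : Set OrientedCircle) (hA : IsTriangularPacking A)
    (hint : IsIntegralPacking A) (hprim : IsPrimitivePacking A) (hchi : HasChiTwo A (-1)) :
    (HasType A {1} → (∀ n : ℤ, n ^ 2 ∉ curvatures A) ∧ ¬ LocalGlobal A) ∧
    (HasType A {3, 11} → (∀ n : ℤ, 3 * n ^ 2 ∉ curvatures A) ∧ ¬ LocalGlobal A) := by
  obtain ⟨g, rfl⟩ := hA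
  -- the packing consists of the images under `g` of the circles given by the orbit in the lattice
  have hmem : ∀ {D C}, Orbit D → Represents D C → C.moebius g ∈
      {C | ApollonianOrbit (OrientedCircle.moebius g '' gridBase)
        (OrientedCircle.moebius g '' gridDual) C} := by
    intro D C hD h
    obtain ⟨C', hC', h'⟩ := hD.exists_apollonianOrbit
    rw [h.unique h']
    exact (apollonianOrbit_moebius_iff g _ _ _).mpr ⟨C', hC', rfl⟩
  have hmem' : ∀ C ∈ {C | ApollonianOrbit (OrientedCircle.moebius g '' gridBase)
      (OrientedCircle.moebius g '' gridDual) C}, ∃ D C', Orbit D ∧ Represents D C' ∧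
        C = C'.moebius g := by
    intro C hC
    obtain ⟨C', hC', rfl⟩ := (apollonianOrbit_moebius_iff g _ _ _).mp hC
    obtain ⟨D, hD, h⟩ := exists_represents_of_orbit hC'
    exact ⟨D, C', hD, h, rfl⟩
  generalize {C | ApollonianOrbit (OrientedCircle.moebius g '' gridBase)
    (OrientedCircle.moebius g '' gridDual) C} = A at *
  obtain ⟨l, hk, hAk, hcurv⟩ := exists_nullForm fun D C hD h => hint _ (hmem hD h)
  have hcur : curvatures A = {n | ∃ D, Orbit D ∧ l.eval D = n} := by
    ext n
    constructor
    · rintro ⟨C, hC, hn⟩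
      obtain ⟨D, C', hD, h, rfl⟩ := hmem' C hC
      rw [hcurv D C' h] at hn
      exact ⟨D, hD, by exact_mod_cast hn⟩
    · rintro ⟨D, hD, rfl⟩
      obtain ⟨C, -, h⟩ := hD.exists_apollonianOrbit
      exact ⟨C.moebius g, hmem hD h, hcurv D C h⟩
  have hchi' : ∃ C, Orbit C ∧ LatticeHasChiTwoAt l C (-1) := by
    obtain ⟨C, hC, D, hD, htan, a, b, ha, hb, hcop, hε⟩ := hchi
    obtain ⟨C₀, C', hC₀, hC', rfl⟩ := hmem' C hC
    obtain ⟨D₀, D', hD₀, hD', rfl⟩ := hmem' D hD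
    rw [hcurv _ _ hC'] at ha
    rw [hcurv _ _ hD'] at hb
    obtain rfl : l.eval C₀ = a := by exact_mod_cast ha
    obtain rfl : l.eval D₀ = b := by exact_mod_cast hb
    rw [OrientedCircle.Tangent, inversiveProduct_moebius, hC'.inversiveProduct hD'] at htan
    exact ⟨C₀, hC₀, D₀, hD₀, by exact_mod_cast htan, hcop, hε⟩
  have hpr : ∀ p : ℕ, p.Prime → ∃ D, Orbit D ∧ ¬ (p : ℤ) ∣ l.eval D := by
    intro p hp
    by_contra! hc
    refine hp.one_lt.ne' (hprim p ?_)
    rw [hcur]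
    rintro _ ⟨D, hD, rfl⟩
    exact hc D hD
  have hnn : ∀ C D, Orbit C → Orbit D → inner C D = -1 → 0 ≤ l.eval C + l.eval D :=
    fun C D hC hD h => l.add_nonneg_of_tangent hk hAk hC hD h
  have hadm : ∀ n : ℤ, (∀ M : ℕ, M ≠ 0 → ∃ D, Orbit D ∧ n ≡ l.eval D [ZMOD M]) →
      IsAdmissible A n := by
    intro n h m hm
    obtain ⟨D, hD, hn⟩ := h m hm.ne'
    exact ⟨l.eval D, by rw [hcur]; exact ⟨D, hD, rfl⟩, hn⟩
  rw [HasType, HasType, LocalGlobal, hcur]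
  constructor
  · intro htype
    have h1 : ∀ D, Orbit D → l.eval D % 12 = 1 := by
      intro D hD
      have h : ((l.eval D : ℤ) : ZMod 12) ∈ ({1} : Set (ZMod 12)) :=
        htype ▸ ⟨l.eval D, ⟨D, hD, rfl⟩, rfl⟩
      have h' : ((l.eval D : ℤ) : ZMod 12) = ((1 : ℤ) : ZMod 12) := by simpa using h
      exact (ZMod.intCast_eq_intCast_iff _ _ 12).mp h'
    have hl : IsRegular l := ⟨hpr, hnn, Or.inl h1⟩
    have hno : ∀ n : ℤ, n ^ 2 ∉ {n | ∃ D, Orbit D ∧ l.eval D = n} := by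
      rintro n ⟨D, hD, hn⟩
      exact hl.sq_ne_eval h1 hchi' hD n hn
    refine ⟨hno, ?_⟩
    rintro ⟨Z, hZ⟩
    obtain ⟨n, hn, hloc⟩ := hl.exists_large_sq h1 Z
    exact hno n (hZ _ hn (hadm _ hloc))
  · intro htype
    have h1 : ∀ D, Orbit D → l.eval D % 12 = 3 ∨ l.eval D % 12 = 11 := by
      intro D hD
      have h : ((l.eval D : ℤ) : ZMod 12) ∈ ({3, 11} : Set (ZMod 12)) :=
        htype ▸ ⟨l.eval D, ⟨D, hD, rfl⟩, rfl⟩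
      rcases h with h | h
      · exact Or.inl ((ZMod.intCast_eq_intCast_iff _ 3 12).mp (by simpa using h))
      · exact Or.inr ((ZMod.intCast_eq_intCast_iff _ 11 12).mp (by simpa using h))
    have h3 : ∃ D, Orbit D ∧ 3 ∣ l.eval D := by
      have h : (3 : ZMod 12) ∈ (fun n : ℤ => (n : ZMod 12)) '' {n | ∃ D, Orbit D ∧ l.eval D = n} :=
        htype ▸ Or.inl rfl
      obtain ⟨_, ⟨D, hD, rfl⟩, hn⟩ := h
      have := (ZMod.intCast_eq_intCast_iff (l.eval D) 3 12).mp (by simpa using hn)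
      have h12 : l.eval D % 12 = 3 := this
      exact ⟨D, hD, by omega⟩
    have hl : IsRegular l := ⟨hpr, hnn, Or.inr ⟨h1, h3⟩⟩
    have hno : ∀ n : ℤ, 3 * n ^ 2 ∉ {n | ∃ D, Orbit D ∧ l.eval D = n} := by
      rintro n ⟨D, hD, hn⟩
      exact hl.three_mul_sq_ne_eval h1 hchi' hD n hn
    refine ⟨hno, ?_⟩
    rintro ⟨Z, hZ⟩
    obtain ⟨n, hn, hloc⟩ := hl.exists_large_three_mul_sq h1 Z
    exact hno n (hZ _ hn (hadm _ hloc))
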